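/- Let $d \ge 0$ be an integer. Let $\mathcal F_d$ be the class of upper semi-continuous functions $f:\mathbb R^d\to[0,\infty)$ with $\int_{\mathbb R^d} f(x)\,dx=1$ such that $\log f:\mathbb R^d\to[-\infty,\infty)$ is concave (with $\log 0:=-\infty$). Let $\mathcal P_d$ be the class of Borel probability measures $P$ on $\mathbb R^d$ with $\int\|x\|\,dP(x)<\infty$ and $P(H)<1$ for every hyperplane $H=\{x: v^\top x=c\}$, $v\ne 0$. A log-concave projection of $P\in\mathcal P_d$ is a function $f^*\in\mathcal F_d$ that maximises $\int \log f\,dP$ (an element of $[-\infty,\infty)$) over $f\in\mathcal F_d$. Let $P\in\mathcal P_d$. Then a log-concave projection $f^*$ of $P$ exists, and for every such $f^*$ the measure $P^*(B):=\int_B f^*(x)\,dx$ satisfies the following. (a) For every convex $h:\mathbb R^d\to(-\infty,\infty]$, the negative part of $h$ has finite integral with respect to both $P^*$ and $P$, and, in $(-\infty,\infty]$, $$\int_{\mathbb R^d} h\,dP^*\le\int_{\mathbb R^d} h\,dP .$$ (b) The mean is preserved: $\int\|x\|\,dP^*(x)<\infty$ and $\int x\,dP^*(x)=\int x\,dP(x)=:\mu$.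 (c) The covariance shrinks: $\int\|x\|^2\,dP^*(x)<\infty$, and for every $v\in\mathbb R^d$ $$\int (v^\top(x-\mu))^2\,dP^*(x)\le\int (v^\top(x-\mu))^2\,dP(x)\in[0,\infty].$$ If moreover $\int\|x\|^2\,dP(x)<\infty$, then the matrix $\int (x-\mu)(x-\mu)^\top dP(x)-\int (x-\mu)(x-\mu)^\top dP^*(x)$ is non-negative definite. -/

import Mathlib

open MeasureTheory
open scoped ENNReal NNReal

namespace LogConcaveProjection

/-- Integral `∫ f⁺ dμ - ∫ f⁻ dμ` of a function with values in `[-∞, ∞]`. It is the usual extended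
integral when `f` is measurable and one of the two terms is finite. -/
noncomputable def extIntegral {Ω : Type*} [MeasurableSpace Ω] (μ : Measure Ω) (f : Ω → EReal) :
    EReal :=
  ((∫⁻ x, (f x).toENNReal ∂μ : ℝ≥0∞) : EReal) - ((∫⁻ x, (-f x).toENNReal ∂μ : ℝ≥0∞) : EReal)

/-- Convex functions `h : E → (-∞, ∞]`. -/
def IsExtConvex {E : Type*} [AddCommGroup E] [Module ℝ E] (h : E → EReal) : Prop :=
  (∀ x, h x ≠ ⊥) ∧
    ∀ x y : E, ∀ a b : ℝ, 0 < a → 0 < b → a + b = 1 →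
      h (a • x + b • y) ≤ (a : EReal) * h x + (b : EReal) * h y

/-- Concave functions `φ : E → [-∞, ∞)`. -/
def IsExtConcave {E : Type*} [AddCommGroup E] [Module ℝ E] (φ : E → EReal) : Prop :=
  (∀ x, φ x ≠ ⊤) ∧
    ∀ x y : E, ∀ a b : ℝ, 0 < a → 0 < b → a + b = 1 →
      (a : EReal) * φ x + (b : EReal) * φ y ≤ φ (a • x + b • y)

/-- `log f`, with `log 0 = -∞`. -/
noncomputable def logFun {E : Type*} (f : E → ℝ≥0) (x : E) : EReal :=
  ENNReal.log (f x : ℝ≥0∞)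

/-- The class `𝓕_d` of upper semicontinuous log-concave densities on `ℝ^d`. -/
structure IsLogConcaveDensity {d : ℕ} (f : EuclideanSpace ℝ (Fin d) → ℝ≥0) : Prop where
  upperSemicontinuous : UpperSemicontinuous f
  logConcave : IsExtConcave (logFun f)
  lintegral_eq_one : ∫⁻ x, (f x : ℝ≥0∞) = 1

/-- The class `𝓟_d` of probability measures on `ℝ^d` with finite first absolute moment that give
mass less than one to every hyperplane. -/
structure MemPd {d : ℕ} (P : Measure (EuclideanSpace ℝ (Fin d))) : Prop where
  isProbabilityMeasure : IsProbabilityMeasure P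
  firstMoment : ∫⁻ x, ‖x‖ₑ ∂P < ∞
  hyperplane : ∀ v : EuclideanSpace ℝ (Fin d), v ≠ 0 → ∀ c : ℝ, P {x | inner ℝ v x = c} < 1

/-- `f` is a log-concave projection of `P`: it maximises `∫ log g dP` over `g ∈ 𝓕_d`. -/
def IsProjection {d : ℕ} (P : Measure (EuclideanSpace ℝ (Fin d)))
    (f : EuclideanSpace ℝ (Fin d) → ℝ≥0) : Prop :=
  IsLogConcaveDensity f ∧
    ∀ g : EuclideanSpace ℝ (Fin d) → ℝ≥0, IsLogConcaveDensity g →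
      extIntegral P (logFun g) ≤ extIntegral P (logFun f)

/-- The measure `B ↦ ∫_B f` with Lebesgue density `f`. -/
noncomputable def densityMeasure {d : ℕ} (f : EuclideanSpace ℝ (Fin d) → ℝ≥0) :
    Measure (EuclideanSpace ℝ (Fin d)) :=
  volume.withDensity (fun x => (f x : ℝ≥0∞))

/-- The matrix `∫ (x - m)(x - m)ᵀ dQ(x)`. -/
noncomputable def secondMomentMatrix {d : ℕ} (Q : Measure (EuclideanSpace ℝ (Fin d)))
    (m : EuclideanSpace ℝ (Fin d)) : Matrix (Fin d) (Fin d) ℝ :=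
  Matrix.of fun i j => ∫ x, (x i - m i) * (x j - m j) ∂Q

end LogConcaveProjection

/-! Existence. Take log-concave densities `exp (B - u n)`, with `u n` convex, whose objective values
tend to the supremum. Since `P` has a first moment and charges no hyperplane fully, a near-optimal
density cannot be too peaked, which makes `B` uniform. Normalising `exp (-(u n + u m) / 2)` gives
another competitor, so this function cannot integrate to much less than `exp (-B)`. This forces the
square roots `exp (-u n / 2)` to be Cauchy in `L²`, so `u n` converges almost everywhere, and
Fatou's lemma shows that the lower semicontinuous hull of its limit gives a maximiser.

Convex order. For `H ≥ 0` convex and lower semicontinuous, comparing the maximiser `f` with the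
normalisation of `f exp (-H)` yields `exp (-∫ H dP) ≤ ∫ exp (-H) dP*`. Applying this to `H / n` and
letting `n → ∞` gives `∫ H dP* ≤ ∫ H dP`. For linear `l` this applies to the positive parts of
`n ± l`, and `n → ∞` shows that `l` has the same integral under `P` and `P*`. A general convex `h`
is the sum of an affine function and a nonnegative convex function, and the latter agrees with its
lower semicontinuous hull outside a Lebesgue null set. Finally, a log-concave density decays
exponentially, so `P*` has finite second moments. -/

namespace LogConcaveProjection

open Set Filter Topology

section ExpNeg

/-- The function `exp (-u)` of `u ∈ [0, ∞]`. -/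
noncomputable def expNeg (u : ℝ≥0∞) : ℝ≥0∞ := EReal.exp (-(u : EReal))

lemma expNeg_zero : expNeg 0 = 1 := by simp [expNeg]

lemma expNeg_le_one (u : ℝ≥0∞) : expNeg u ≤ 1 := by
  simp [expNeg, EReal.coe_ennreal_nonneg]

lemma expNeg_ne_top (u : ℝ≥0∞) : expNeg u ≠ ∞ := ((expNeg_le_one u).trans_lt (by simp)).ne

lemma expNeg_antitone : Antitone expNeg := fun a b h => by
  simpa [expNeg] using h

lemma continuous_expNeg : Continuous expNeg :=
  ENNReal.continuous_exp.comp (continuous_neg.comp continuous_coe_ennreal_ereal)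

lemma expNeg_ofReal {r : ℝ} (hr : 0 ≤ r) :
    expNeg (ENNReal.ofReal r) = ENNReal.ofReal (Real.exp (-r)) := by
  rw [expNeg, EReal.coe_ennreal_ofReal, max_eq_left hr, ← EReal.coe_neg, EReal.exp_coe]

lemma expNeg_eq_zero {u : ℝ≥0∞} : expNeg u = 0 ↔ u = ∞ := by
  simp [expNeg]

lemma expNeg_add (u v : ℝ≥0∞) : expNeg (u + v) = expNeg u * expNeg v := by
  rw [expNeg, expNeg, expNeg, ← EReal.exp_add, EReal.coe_ennreal_add,
    EReal.neg_add (by simp) (by simp), sub_eq_add_neg]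

end ExpNeg

section ExtIntegral

variable {Ω : Type*} [MeasurableSpace Ω] {μ : Measure Ω}

lemma extIntegral_mono {g h : Ω → EReal} (hgh : ∀ x, g x ≤ h x) :
    extIntegral μ g ≤ extIntegral μ h := by
  refine EReal.sub_le_sub ?_ ?_ <;> rw [EReal.coe_ennreal_le_coe_ennreal_iff]
  · exact lintegral_mono fun x => EReal.toENNReal_le_toENNReal (hgh x)
  · exact lintegral_mono fun x => EReal.toENNReal_le_toENNReal (EReal.neg_le_neg_iff.2 (hgh x))

lemma extIntegral_congr_ae {g h : Ω → EReal} (hgh : g =ᵐ[μ] h) :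
    extIntegral μ g = extIntegral μ h := by
  have hpos : ∫⁻ x, (g x).toENNReal ∂μ = ∫⁻ x, (h x).toENNReal ∂μ :=
    lintegral_congr_ae (hgh.fun_comp EReal.toENNReal)
  have hneg : ∫⁻ x, (-g x).toENNReal ∂μ = ∫⁻ x, (-h x).toENNReal ∂μ :=
    lintegral_congr_ae (hgh.fun_comp fun t => (-t).toENNReal)
  rw [extIntegral, extIntegral, hpos, hneg]

lemma toENNReal_coe_sub_coe (p q : ℝ≥0∞) : ((p : EReal) - q).toENNReal = p - q := by
  rw [EReal.toENNReal_sub (EReal.coe_ennreal_nonneg q), EReal.toENNReal_coe, EReal.toENNReal_coe]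

lemma toENNReal_neg_coe_sub_coe_add (p q : ℝ≥0∞) :
    (-((p : EReal) - q)).toENNReal + p = max p q := by
  rcases eq_or_ne p ∞ with rfl | hp
  · simp
  · rw [EReal.neg_sub (by simp) (by simp [hp]), add_comm (-_), ← sub_eq_add_neg,
      toENNReal_coe_sub_coe, tsub_add_eq_max, max_comm]

lemma coe_sub_coe_eq_of_add_eq {a b c d : ℝ≥0∞} (h : a + b = c + d)
    (hfin : a ≠ ∞ ∧ d ≠ ∞ ∨ b ≠ ∞ ∧ c ≠ ∞) : (a : EReal) - c = (d : EReal) - b := by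
  have key {a b c d : ℝ≥0∞} (h : a + b = c + d) (ha : a ≠ ∞) (hd : d ≠ ∞) :
      (a : EReal) - c = (d : EReal) - b := by
    rcases eq_or_ne b ∞ with rfl | hb
    · have hc : c = ∞ := by simpa [hd, eq_comm] using h
      simp [hc]
    · have hc : c ≠ ∞ := by
        rintro rfl
        simp [ha, hb] at h
      lift a to ℝ≥0 using ha
      lift b to ℝ≥0 using hb
      lift c to ℝ≥0 using hc
      lift d to ℝ≥0 using hd
      have hsum : (a : ℝ) + b = c + d := by exact_mod_cast h
      simp only [EReal.coe_nnreal_eq_coe_real]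
      norm_cast
      linarith
  rcases hfin with ⟨ha, hd⟩ | ⟨hb, hc⟩
  · exact key h ha hd
  · have hneg := congrArg Neg.neg (key h.symm hc hb)
    rwa [EReal.neg_sub (by simp) (by simp [hc]), EReal.neg_sub (by simp) (by simp [hb]),
      add_comm, add_comm (-_), ← sub_eq_add_neg, ← sub_eq_add_neg] at hneg

lemma extIntegral_coe_sub_coe {p q : Ω → ℝ≥0∞} (hp : Measurable p) (hq : Measurable q)
    (hfin : ∫⁻ x, p x ∂μ ≠ ∞ ∨ ∫⁻ x, q x ∂μ ≠ ∞) :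
    extIntegral μ (fun x => (p x : EReal) - q x) =
      ((∫⁻ x, p x ∂μ : ℝ≥0∞) : EReal) - ((∫⁻ x, q x ∂μ : ℝ≥0∞) : EReal) := by
  have hpos_le : ∫⁻ x, ((p x : EReal) - q x).toENNReal ∂μ ≤ ∫⁻ x, p x ∂μ :=
    lintegral_mono fun x => (toENNReal_coe_sub_coe _ _).trans_le tsub_le_self
  have hneg_le : ∫⁻ x, (-((p x : EReal) - q x)).toENNReal ∂μ ≤ ∫⁻ x, q x ∂μ := by
    refine lintegral_mono fun x => ?_
    refine (EReal.toENNReal_le_toENNReal (EReal.neg_le_of_neg_le ?_)).trans_eq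
      (EReal.toENNReal_coe (x := q x))
    rw [sub_eq_add_neg]
    exact le_add_of_nonneg_left (EReal.coe_ennreal_nonneg _)
  have hsum : ∫⁻ x, ((p x : EReal) - q x).toENNReal ∂μ + ∫⁻ x, q x ∂μ =
      ∫⁻ x, (-((p x : EReal) - q x)).toENNReal ∂μ + ∫⁻ x, p x ∂μ := by
    rw [← lintegral_add_right _ hq, ← lintegral_add_right _ hp]
    simp_rw [toENNReal_neg_coe_sub_coe_add, toENNReal_coe_sub_coe, tsub_add_eq_max]
  exact coe_sub_coe_eq_of_add_eq hsum
    (hfin.imp (fun h => ⟨ne_top_of_le_ne_top h hpos_le, h⟩)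
      fun h => ⟨h, ne_top_of_le_ne_top h hneg_le⟩)

lemma extIntegral_coe_add_coe {a : Ω → ℝ} (ha : Integrable a μ) (ham : Measurable a)
    {H : Ω → ℝ≥0∞} (hH : Measurable H) :
    extIntegral μ (fun x => (a x : EReal) + H x) =
      ((∫ x, a x ∂μ : ℝ) : EReal) + ((∫⁻ x, H x ∂μ : ℝ≥0∞) : EReal) := by
  have hpos : ∫⁻ x, ENNReal.ofReal (a x) ∂μ ≠ ∞ := ha.lintegral_lt_top.ne
  have hneg : ∫⁻ x, ENNReal.ofReal (-a x) ∂μ ≠ ∞ := ha.neg.lintegral_lt_top.ne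
  have hsplit (x : Ω) : (a x : EReal) + H x =
      ((ENNReal.ofReal (a x) + H x : ℝ≥0∞) : EReal) - (ENNReal.ofReal (-a x) : ℝ≥0∞) := by
    rw [EReal.coe_real_ereal_eq_coe_toNNReal_sub_coe_toNNReal, EReal.coe_ennreal_add,
      sub_eq_add_neg, sub_eq_add_neg, add_right_comm]
    rfl
  simp_rw [hsplit]
  rw [extIntegral_coe_sub_coe (by fun_prop) (by fun_prop) (.inr hneg), lintegral_add_right _ hH,
    integral_eq_lintegral_pos_part_sub_lintegral_neg_part ha, EReal.coe_sub,
    EReal.coe_ennreal_add, sub_eq_add_neg, sub_eq_add_neg, add_right_comm,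
    EReal.coe_ennreal_toReal hpos, EReal.coe_ennreal_toReal hneg]

lemma extIntegral_coe_const_sub_coe [IsProbabilityMeasure μ] (B : ℝ) {u : Ω → ℝ≥0∞}
    (hu : Measurable u) :
    extIntegral μ (fun x => (B : EReal) - u x) =
      (B : EReal) - ((∫⁻ x, u x ∂μ : ℝ≥0∞) : EReal) := by
  have hsplit (v : ℝ≥0∞) : (B : EReal) - v =
      (ENNReal.ofReal B : EReal) - ((v + ENNReal.ofReal (-B) : ℝ≥0∞) : EReal) := by
    rw [EReal.coe_ennreal_add, sub_eq_add_neg, sub_eq_add_neg, EReal.neg_add (by simp) (by simp),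
      sub_eq_add_neg, add_comm (-(v : EReal)) (-_), ← add_assoc,
      EReal.coe_real_ereal_eq_coe_toNNReal_sub_coe_toNNReal]
    rfl
  simp_rw [hsplit]
  rw [extIntegral_coe_sub_coe measurable_const (hu.add_const _) (.inl (by simp)),
    lintegral_add_right _ measurable_const]
  simp

end ExtIntegral

section ConvexLsc

variable {E : Type*} [NormedAddCommGroup E] [NormedSpace ℝ E] {u v : E → ℝ≥0∞}

/-- Convex lower semicontinuous functions with values in `[0, ∞]`. Convexity is over the scalars
`ℝ≥0`, which act on `ℝ≥0∞`. -/
structure IsConvexLsc (u : E → ℝ≥0∞) : Prop where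
  lowerSemicontinuous : LowerSemicontinuous u
  convexOn : ConvexOn ℝ≥0 univ u

lemma convexOn_nnreal_univ_iff :
    ConvexOn ℝ≥0 univ u ↔ ∀ x y : E, ∀ a b : ℝ, 0 < a → 0 < b → a + b = 1 →
      u (a • x + b • y) ≤ ENNReal.ofReal a * u x + ENNReal.ofReal b * u y := by
  rw [convexOn_iff_forall_pos]
  refine ⟨fun h x y a b ha hb hab => ?_, fun h => ⟨convex_univ, fun x _ y _ a b ha hb hab => ?_⟩⟩
  · lift a to ℝ≥0 using ha.le
    lift b to ℝ≥0 using hb.le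
    simpa [NNReal.smul_def, ENNReal.smul_def] using
      h.2 (mem_univ x) (mem_univ y) (mod_cast ha) (mod_cast hb) (mod_cast hab)
  · simpa [NNReal.smul_def, ENNReal.smul_def] using
      h x y a b (mod_cast ha) (mod_cast hb) (mod_cast hab)

lemma convex_le_of_convexOn (hu : ConvexOn ℝ≥0 univ u) (s : ℝ≥0∞) : Convex ℝ {x | u x ≤ s} := by
  rw [convex_iff_forall_pos]
  intro x hx y hy a b ha hb hab
  lift a to ℝ≥0 using ha.le
  lift b to ℝ≥0 using hb.le
  exact (hu.convex_le s ⟨mem_univ x, hx⟩ ⟨mem_univ y, hy⟩ zero_le zero_le (mod_cast hab)).2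

namespace IsConvexLsc

lemma measurable [MeasurableSpace E] [BorelSpace E] (hu : IsConvexLsc u) : Measurable u :=
  hu.lowerSemicontinuous.measurable

lemma le_of_add_eq_one (hu : IsConvexLsc u) (x y : E) {a b : ℝ} (ha : 0 < a) (hb : 0 < b)
    (hab : a + b = 1) :
    u (a • x + b • y) ≤ ENNReal.ofReal a * u x + ENNReal.ofReal b * u y :=
  convexOn_nnreal_univ_iff.1 hu.convexOn x y a b ha hb hab

lemma add (hu : IsConvexLsc u) (hv : IsConvexLsc v) : IsConvexLsc (fun x => u x + v x) :=
  ⟨hu.lowerSemicontinuous.add hv.lowerSemicontinuous, hu.convexOn.add hv.convexOn⟩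

lemma const_mul (hu : IsConvexLsc u) {c : ℝ≥0∞} (hc : c ≠ ∞) :
    IsConvexLsc (fun x => c * u x) where
  lowerSemicontinuous := (ENNReal.continuous_const_mul hc).comp_lowerSemicontinuous
    hu.lowerSemicontinuous fun _ _ h => mul_le_mul_right h _
  convexOn := by
    lift c to ℝ≥0 using hc
    exact hu.convexOn.smul (zero_le (a := c))

lemma convex_le (hu : IsConvexLsc u) (s : ℝ≥0∞) : Convex ℝ {x | u x ≤ s} :=
  convex_le_of_convexOn hu.convexOn s

lemma isClosed_le (hu : IsConvexLsc u) (s : ℝ≥0∞) : IsClosed {x | u x ≤ s} :=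
  hu.lowerSemicontinuous.isClosed_preimage s

end IsConvexLsc

lemma isConvexLsc_enorm : IsConvexLsc fun x : E => ‖x‖ₑ where
  lowerSemicontinuous := continuous_enorm.lowerSemicontinuous
  convexOn := convexOn_nnreal_univ_iff.2 fun x y a b ha hb _ => by
    refine (enorm_add_le _ _).trans ?_
    rw [enorm_smul, enorm_smul, Real.enorm_of_nonneg ha.le, Real.enorm_of_nonneg hb.le]

lemma isConvexLsc_ofReal {w : E → ℝ} (hc : Continuous w) (hw : ConvexOn ℝ univ w) :
    IsConvexLsc fun x => ENNReal.ofReal (w x) where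
  lowerSemicontinuous := (ENNReal.continuous_ofReal.comp hc).lowerSemicontinuous
  convexOn := convexOn_nnreal_univ_iff.2 fun x y a b ha hb hab => by
    rw [← ENNReal.ofReal_mul ha.le, ← ENNReal.ofReal_mul hb.le]
    exact (ENNReal.ofReal_le_ofReal (hw.2 (mem_univ x) (mem_univ y) ha.le hb.le hab)).trans
      ENNReal.ofReal_add_le

end ConvexLsc

section Exponent

variable {E : Type*} {B : ℝ} {u : E → ℝ≥0∞} {f : E → ℝ≥0} {x : E}

/-- The function `exp (B - u)`. -/
noncomputable def expDensity (B : ℝ) (u : E → ℝ≥0∞) (x : E) : ℝ≥0 :=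
  (EReal.exp ((B : EReal) - u x)).toNNReal

/-- The part of `B - log f` that is nonnegative; when `f ≤ exp B` it is `B - log f`, so that
`f = exp (B - exponent B f)`. -/
noncomputable def exponent (B : ℝ) (f : E → ℝ≥0) (x : E) : ℝ≥0∞ :=
  ((B : EReal) - logFun f x).toENNReal

lemma logFun_ne_top (f : E → ℝ≥0) (x : E) : logFun f x ≠ ⊤ := by simp [logFun]

lemma logFun_expDensity (B : ℝ) (u : E → ℝ≥0∞) (x : E) :
    logFun (expDensity B u) x = (B : EReal) - u x := by
  have hle : (B : EReal) - u x ≤ B := by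
    simpa using EReal.sub_le_sub (le_refl (B : EReal)) (EReal.coe_ennreal_nonneg (u x))
  have hne : EReal.exp ((B : EReal) - u x) ≠ ∞ := by
    rw [Ne, EReal.exp_eq_top_iff]
    exact (hle.trans_lt (EReal.coe_lt_top B)).ne
  rw [logFun, expDensity, ENNReal.coe_toNNReal hne, EReal.log_exp]

lemma coe_eq_exp_mul_expNeg (h : logFun f x = (B : EReal) - u x) :
    (f x : ℝ≥0∞) = ENNReal.ofReal (Real.exp B) * expNeg (u x) := by
  have hexp := congrArg EReal.exp h
  rwa [logFun, ENNReal.exp_log, sub_eq_add_neg, EReal.exp_add, EReal.exp_coe] at hexp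

lemma logFun_eq_sub_exponent (h : logFun f x ≤ B) :
    logFun f x = (B : EReal) - exponent B f x := by
  rw [exponent, EReal.coe_toENNReal (EReal.sub_nonneg (by simp) (by simp) |>.2 h)]
  generalize logFun f x = t at *
  induction t with
  | bot => simp
  | coe r => rw [← EReal.coe_sub, ← EReal.coe_sub, sub_sub_cancel]
  | top => simp at h

lemma coe_le_coe_sub_coe_iff {L b : ℝ} {J : ℝ≥0∞} :
    (L : EReal) ≤ b - J ↔ L ≤ b ∧ J ≤ ENNReal.ofReal (b - L) := by
  rcases eq_or_ne J ∞ with rfl | hJ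
  · simp
  rw [← ENNReal.ofReal_toReal hJ, EReal.coe_ennreal_ofReal, max_eq_left ENNReal.toReal_nonneg,
    ← EReal.coe_sub, EReal.coe_le_coe_iff]
  have hJ0 : 0 ≤ J.toReal := ENNReal.toReal_nonneg
  constructor
  · intro h
    exact ⟨by linarith, ENNReal.ofReal_le_ofReal (by linarith)⟩
  · rintro ⟨hLb, h⟩
    rw [ENNReal.ofReal_le_ofReal_iff (by linarith)] at h
    linarith

lemma le_logFun_of_exponent_le {b s : ℝ} (hs : 0 ≤ s)
    (hb : logFun f x ≤ b) (h : exponent b f x ≤ ENNReal.ofReal s) :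
    ((b - s : ℝ) : EReal) ≤ logFun f x := by
  rw [logFun_eq_sub_exponent hb, coe_le_coe_sub_coe_iff, sub_sub_cancel]
  exact ⟨sub_le_self b hs, h⟩

lemma ofReal_exp_mul_ofReal_exp_neg (B : ℝ) :
    ENNReal.ofReal (Real.exp B) * ENNReal.ofReal (Real.exp (-B)) = 1 := by
  rw [← ENNReal.ofReal_mul (Real.exp_pos B).le, ← Real.exp_add]; simp

lemma lintegral_coe_eq_exp_mul [MeasurableSpace E] {μ : Measure E}
    (h : ∀ x, logFun f x = (B : EReal) - u x) :
    ∫⁻ x, f x ∂μ = ENNReal.ofReal (Real.exp B) * ∫⁻ x, expNeg (u x) ∂μ := by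
  rw [← lintegral_const_mul' _ _ ENNReal.ofReal_ne_top]
  simp_rw [coe_eq_exp_mul_expNeg (h _)]

lemma combination_sub {s t : EReal} (h : s ≠ ⊤ ∧ t ≠ ⊤ ∨ s ≠ ⊥ ∧ t ≠ ⊥) {a b : ℝ} (ha : 0 < a)
    (hb : 0 < b) (hab : a + b = 1) :
    (a : EReal) * (B - s) + b * (B - t) = B - (a * s + b * t) := by
  have hdistrib {c : ℝ} (hc : 0 < c) (r : EReal) : (c : EReal) * (B - r) = c * B + -(c * r) := by
    rw [sub_eq_add_neg, EReal.left_distrib_of_nonneg_of_ne_top (mod_cast hc.le) (by simp), mul_neg]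
  have hB : (a * B + b * B : EReal) = B := by
    norm_cast
    rw [← add_mul, hab, one_mul]
  have htop {c : ℝ} (hc : 0 < c) {r : EReal} (hr : r ≠ ⊤) : (c : EReal) * r ≠ ⊤ := by
    simp [EReal.mul_ne_top, hr, hc.le]
  have hbot {c : ℝ} (hc : 0 < c) {r : EReal} (hr : r ≠ ⊥) : (c : EReal) * r ≠ ⊥ := by
    simp [EReal.mul_ne_bot, hr, hc.le]
  rw [hdistrib ha, hdistrib hb, add_add_add_comm, hB, sub_eq_add_neg, EReal.neg_add,
    ← sub_eq_add_neg]
  · exact h.elim (fun h => .inr (htop hb h.2)) fun h => .inl (hbot ha h.1)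
  · exact h.elim (fun h => .inl (htop ha h.1)) fun h => .inr (hbot hb h.2)

lemma upperSemicontinuous_expDensity [TopologicalSpace E] (B : ℝ) (hu : LowerSemicontinuous u) :
    UpperSemicontinuous (expDensity B u) := by
  have hcoe : UpperSemicontinuous fun x => (expDensity B u x : ℝ≥0∞) := by
    simp_rw [coe_eq_exp_mul_expNeg (logFun_expDensity B u _)]
    exact ((ENNReal.continuous_const_mul ENNReal.ofReal_ne_top).comp
      continuous_expNeg).comp_lowerSemicontinuous_antitone hu
      fun _ _ h => mul_le_mul_right (expNeg_antitone h) _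
  intro x c hc
  filter_upwards [hcoe x c (by simpa using hc)] with y hy
  simpa using hy

variable [NormedAddCommGroup E] [NormedSpace ℝ E]

lemma isExtConcave_logFun_expDensity (B : ℝ) (hu : ConvexOn ℝ≥0 univ u) :
    IsExtConcave (logFun (expDensity B u)) := by
  refine ⟨logFun_ne_top _, fun x y a b ha hb hab => ?_⟩
  simp only [logFun_expDensity]
  rw [combination_sub (.inr (by simp)) ha hb hab]
  refine EReal.sub_le_sub le_rfl ?_
  have := EReal.coe_ennreal_le_coe_ennreal_iff.2 (convexOn_nnreal_univ_iff.1 hu x y a b ha hb hab)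
  simpa [ha.le, hb.le] using this

lemma isConvexLsc_exponent (B : ℝ) (hf : UpperSemicontinuous f) (hf' : IsExtConcave (logFun f)) :
    IsConvexLsc (exponent B f) where
  lowerSemicontinuous := by
    have hlog : UpperSemicontinuous (logFun f) :=
      (ENNReal.continuous_log.comp ENNReal.continuous_coe).comp_upperSemicontinuous hf
        fun a b hab => ENNReal.log_monotone (mod_cast hab)
    have hsub : Continuous fun t : EReal => ((B : EReal) - t).toENNReal := by
      refine EReal.continuous_toENNReal.comp (continuous_iff_continuousAt.2 fun t => ?_)
      exact (EReal.continuousAt_add (p := ((B : EReal), -t)) (by simp) (by simp)).comp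
        (f := fun t : EReal => ((B : EReal), -t)) (by fun_prop)
    exact hsub.comp_upperSemicontinuous_antitone hlog fun a b hab =>
      EReal.toENNReal_le_toENNReal (EReal.sub_le_sub le_rfl hab)
  convexOn := convexOn_nnreal_univ_iff.2 fun x y a b ha hb hab => by
    have hcomb := combination_sub (B := B) (.inl ⟨hf'.1 x, hf'.1 y⟩) ha hb hab
    have hle := EReal.sub_le_sub (le_refl (B : EReal)) (hf'.2 x y a b ha hb hab)
    rw [← hcomb] at hle
    refine (EReal.toENNReal_le_toENNReal hle).trans (EReal.toENNReal_add_le.trans_eq ?_)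
    rw [EReal.toENNReal_mul (mod_cast ha.le), EReal.toENNReal_mul (mod_cast hb.le)]
    simp [exponent]

end Exponent

section Density

variable {d : ℕ} {f : EuclideanSpace ℝ (Fin d) → ℝ≥0} {u v : EuclideanSpace ℝ (Fin d) → ℝ≥0∞}
  {B : ℝ} {P : Measure (EuclideanSpace ℝ (Fin d))}

lemma IsLogConcaveDensity.isConvexLsc_exponent (hf : IsLogConcaveDensity f) (B : ℝ) :
    IsConvexLsc (exponent B f) :=
  LogConcaveProjection.isConvexLsc_exponent B hf.upperSemicontinuous hf.logConcave

lemma IsConvexLsc.isLogConcaveDensity_expDensity (hu : IsConvexLsc u)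
    (hInt : ∫⁻ x, expNeg (u x) = ENNReal.ofReal (Real.exp (-B))) :
    IsLogConcaveDensity (expDensity B u) where
  upperSemicontinuous := upperSemicontinuous_expDensity B hu.lowerSemicontinuous
  logConcave := isExtConcave_logFun_expDensity B hu.convexOn
  lintegral_eq_one := by
    rw [lintegral_coe_eq_exp_mul (logFun_expDensity B u), hInt, ofReal_exp_mul_ofReal_exp_neg]

lemma IsLogConcaveDensity.lintegral_expNeg_exponent (hf : IsLogConcaveDensity f)
    (h : ∀ x, logFun f x ≤ B) :
    ∫⁻ x, expNeg (exponent B f x) = ENNReal.ofReal (Real.exp (-B)) := by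
  have hone := hf.lintegral_eq_one
  rw [lintegral_coe_eq_exp_mul fun x => logFun_eq_sub_exponent (h x)] at hone
  rw [← one_mul (∫⁻ x, _), ← ofReal_exp_mul_ofReal_exp_neg B, mul_right_comm, hone, one_mul]

lemma extIntegral_logFun_expDensity [IsProbabilityMeasure P] (hu : IsConvexLsc u) (B : ℝ) :
    extIntegral P (logFun (expDensity B u)) =
      (B : EReal) - ((∫⁻ x, u x ∂P : ℝ≥0∞) : EReal) := by
  rw [← extIntegral_coe_const_sub_coe B hu.measurable]
  exact congrArg _ (funext (logFun_expDensity B u))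

lemma IsLogConcaveDensity.extIntegral_logFun_eq [IsProbabilityMeasure P]
    (hf : IsLogConcaveDensity f) (h : ∀ x, logFun f x ≤ B) :
    extIntegral P (logFun f) = (B : EReal) - ((∫⁻ x, exponent B f x ∂P : ℝ≥0∞) : EReal) := by
  rw [← extIntegral_coe_const_sub_coe B (hf.isConvexLsc_exponent B).measurable]
  exact congrArg _ (funext fun x => logFun_eq_sub_exponent (h x))

lemma IsConvexLsc.exists_isLogConcaveDensity_extIntegral_eq [IsProbabilityMeasure P]
    (hv : IsConvexLsc v) (h0 : ∫⁻ x, expNeg (v x) ≠ 0) (ht : ∫⁻ x, expNeg (v x) ≠ ∞) :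
    ∃ g, IsLogConcaveDensity g ∧ extIntegral P (logFun g) =
      ((-Real.log (∫⁻ x, expNeg (v x)).toReal : ℝ) : EReal) - ((∫⁻ x, v x ∂P : ℝ≥0∞) : EReal) := by
  refine ⟨expDensity (-Real.log (∫⁻ x, expNeg (v x)).toReal) v,
    hv.isLogConcaveDensity_expDensity ?_, extIntegral_logFun_expDensity hv _⟩
  rw [neg_neg, Real.exp_log (ENNReal.toReal_pos h0 ht), ENNReal.ofReal_toReal ht]

end Density

section Geometry

variable {E : Type*} [NormedAddCommGroup E] [NormedSpace ℝ E]

lemma closedBall_subset_of_closedBall_add_subset_thickening {C : Set E} (hC : Convex ℝ C)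
    (hCc : IsClosed C) {z : E} {r ρ : ℝ} (hρ : 0 < ρ)
    (h : Metric.closedBall z (r + ρ) ⊆ Metric.thickening ρ C) : Metric.closedBall z r ⊆ C := by
  intro w hw
  by_contra hwC
  obtain ⟨f, t, hft, htw⟩ := geometric_hahn_banach_closed_point hC hCc hwC
  have hlt (v : E) (hv : ‖v‖ ≤ ρ) : f v < t - f w + ‖f‖ * ρ := by
    have hmem : w + v ∈ Metric.closedBall z (r + ρ) := by
      rw [mem_closedBall_iff_norm] at hw ⊢
      calc ‖w + v - z‖ = ‖(w - z) + v‖ := by congr 1; abel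
        _ ≤ r + ρ := (norm_add_le _ _).trans (add_le_add hw hv)
    obtain ⟨c, hc, hdist⟩ := Metric.mem_thickening_iff.1 (h hmem)
    have hle : f (w + v) - f c ≤ ‖f‖ * ρ := by
      rw [← map_sub]
      refine (f.le_opNorm_of_le (dist_eq_norm (w + v) c ▸ hdist.le)).trans' (le_abs_self _)
    rw [map_add] at hle
    linarith [hft c hc]
  have hnorm := f.opNorm_bound_of_ball_bound hρ (t - f w + ‖f‖ * ρ) fun v hv => by
    rw [mem_closedBall_zero_iff] at hv
    refine abs_le.2 ⟨?_, (hlt v hv).le⟩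
    linarith [hlt (-v) (by rwa [norm_neg]), map_neg f v]
  rw [le_div_iff₀ hρ] at hnorm
  linarith

lemma exists_eq_combination_of_mem_closedBall {y z w : E} {ρ l : ℝ} (hl : 0 < l)
    (hw : w ∈ Metric.closedBall ((1 - l) • y + l • z) (l * ρ)) :
    ∃ x ∈ Metric.closedBall z ρ, w = (1 - l) • y + l • x := by
  refine ⟨z + l⁻¹ • (w - ((1 - l) • y + l • z)), ?_, ?_⟩
  · rw [mem_closedBall_iff_norm] at hw ⊢
    rwa [add_sub_cancel_left, norm_smul, norm_inv, Real.norm_of_nonneg hl.le, inv_mul_le_iff₀ hl]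
  · rw [smul_add, smul_smul, mul_inv_cancel₀ hl.ne', one_smul]
    abel

lemma exists_closedBall_subset_of_measure_compl_lt [FiniteDimensional ℝ E] [MeasurableSpace E]
    {P : Measure E} (hspan : affineSpan ℝ P.support = ⊤) :
    ∃ (z : E) (ρ : ℝ) (ε : ℝ≥0∞), 0 < ρ ∧ 0 < ε ∧
      ∀ C : Set E, Convex ℝ C → IsClosed C → P Cᶜ < ε → Metric.closedBall z ρ ⊆ C := by
  obtain ⟨t, htS, htspan, htind⟩ := exists_affineIndependent ℝ E P.support
  have htfin : t.Finite := finite_set_of_fin_dim_affineIndependent ℝ htind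
  obtain ⟨z, hz⟩ := interior_convexHull_nonempty_iff_affineSpan_eq_top.2 (htspan.trans hspan)
  obtain ⟨r, hr, hball⟩ := Metric.nhds_basis_closedBall.mem_iff.1 (mem_interior_iff_mem_nhds.1 hz)
  refine ⟨z, r / 2, htfin.toFinset.inf fun x => P (Metric.ball x (r / 2)), by positivity, ?_,
    fun C hC hCc hPC => ?_⟩
  · rw [Finset.lt_inf_iff (by simp)]
    intro x hx
    exact (Measure.mem_support_iff_forall x).1 (htS (by simpa using hx)) _
      (Metric.ball_mem_nhds _ (by positivity))
  refine closedBall_subset_of_closedBall_add_subset_thickening hC hCc (half_pos hr) ?_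
  rw [add_halves]
  refine hball.trans (convexHull_min (fun x hx => ?_) (hC.thickening _))
  have hlt : P Cᶜ < P (Metric.ball x (r / 2)) :=
    hPC.trans_le (Finset.inf_le (f := fun x => P (Metric.ball x (r / 2))) (by simpa using hx))
  obtain ⟨y, hyball, hyC⟩ := not_subset.1 fun hsub => (measure_mono hsub).not_gt hlt
  exact Metric.mem_thickening_iff.2 ⟨y, not_not.1 hyC, Metric.mem_ball'.1 hyball⟩

lemma exists_subset_hyperplane_of_affineSpan_ne_top {F : Type*} [NormedAddCommGroup F]
    [InnerProductSpace ℝ F] [FiniteDimensional ℝ F] {S : Set F} (hS : S.Nonempty)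
    (h : affineSpan ℝ S ≠ ⊤) : ∃ v : F, v ≠ 0 ∧ ∃ c : ℝ, S ⊆ {x | inner ℝ v x = c} := by
  obtain ⟨x₀, hx₀⟩ := hS
  have hx₀' : x₀ ∈ affineSpan ℝ S := subset_affineSpan ℝ S hx₀
  have hdir : (affineSpan ℝ S).direction ≠ ⊤ := by
    rwa [Ne, AffineSubspace.direction_eq_top_iff_of_nonempty ⟨x₀, hx₀'⟩]
  have horth : (affineSpan ℝ S).directionᗮ ≠ ⊥ := by
    rwa [Ne, Submodule.orthogonal_eq_bot_iff]
  obtain ⟨v, hv, hv0⟩ := Submodule.exists_mem_ne_zero_of_ne_bot horth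
  refine ⟨v, hv0, inner ℝ v x₀, fun x hx => ?_⟩
  have hvsub : x -ᵥ x₀ ∈ (affineSpan ℝ S).direction :=
    AffineSubspace.vsub_mem_direction (subset_affineSpan ℝ S hx) hx₀'
  simpa [inner_sub_right, sub_eq_zero] using Submodule.inner_left_of_mem_orthogonal hvsub hv

lemma interior_nonempty_of_measure_ne_zero [FiniteDimensional ℝ E] [MeasurableSpace E]
    [BorelSpace E] (μ : Measure E) [μ.IsAddHaarMeasure] {C : Set E} (hC : Convex ℝ C)
    (h : μ C ≠ 0) : (interior C).Nonempty := by
  by_contra hne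
  rw [not_nonempty_iff_eq_empty] at hne
  refine h (measure_mono_null ?_ (hC.addHaar_frontier μ))
  rw [frontier, hne, sdiff_empty]
  exact subset_closure

end Geometry

section Peak

variable {E : Type*} {f : E → ℝ≥0}

lemma ofReal_exp_le_coe_iff {p : ℝ} {x : E} :
    ENNReal.ofReal (Real.exp p) ≤ f x ↔ (p : EReal) ≤ logFun f x := by
  rw [logFun, ← EReal.exp_coe, ← EReal.exp_le_exp_iff, ENNReal.exp_log]

lemma coe_le_ofReal_exp_iff {p : ℝ} {x : E} :
    f x ≤ ENNReal.ofReal (Real.exp p) ↔ logFun f x ≤ p := by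
  rw [logFun, ← EReal.exp_coe, ← EReal.exp_le_exp_iff, ENNReal.exp_log]

variable [NormedAddCommGroup E] [NormedSpace ℝ E]

lemma coe_combination_le_logFun (hf : IsExtConcave (logFun f)) {x y : E} {p q a b : ℝ}
    (hx : (p : EReal) ≤ logFun f x) (hy : (q : EReal) ≤ logFun f y) (ha : 0 < a) (hb : 0 < b)
    (hab : a + b = 1) : ((a * p + b * q : ℝ) : EReal) ≤ logFun f (a • x + b • y) := by
  refine le_trans ?_ (hf.2 x y a b ha hb hab)
  rw [EReal.coe_add, EReal.coe_mul, EReal.coe_mul]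
  exact add_le_add (mul_le_mul_of_nonneg_left hx (mod_cast ha.le))
    (mul_le_mul_of_nonneg_left hy (mod_cast hb.le))

lemma convex_coe_le_logFun (hf : IsExtConcave (logFun f)) (p : ℝ) :
    Convex ℝ {x | (p : EReal) ≤ logFun f x} := by
  rw [convex_iff_forall_pos]
  intro x hx y hy a b ha hb hab
  have := coe_combination_le_logFun hf hx hy ha hb hab
  rwa [← add_mul, hab, one_mul] at this

variable [MeasurableSpace E] [BorelSpace E] [FiniteDimensional ℝ E] {μ : Measure E}
  [μ.IsAddHaarMeasure]

/- On the ball `(1 - l) y + l (closedBall z ρ)` the density is at least `exp ((1 - l) p + l q)`,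
and its mass there is at most one. -/
lemma combination_add_log_measureReal_le_zero (hf : IsExtConcave (logFun f))
    (hInt : ∫⁻ x, f x ∂μ ≤ 1) {y z : E} {ρ p q l : ℝ} (hρ : 0 < ρ) (hl : 0 < l) (hl1 : l < 1)
    (hp : (p : EReal) ≤ logFun f y) (hq : ∀ x ∈ Metric.closedBall z ρ, (q : EReal) ≤ logFun f x) :
    (1 - l) * p + l * q + Real.log (μ.real (Metric.closedBall 0 (l * ρ))) ≤ 0 := by
  set m := (1 - l) * p + l * q
  set V := μ (Metric.closedBall (0 : E) (l * ρ)) with hV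
  have hV0 : 0 < V := Metric.measure_closedBall_pos _ _ (by positivity)
  have hVt : V ≠ ∞ := measure_closedBall_lt_top.ne
  have hmass : ENNReal.ofReal (Real.exp m) * V ≤ 1 := by
    rw [hV, ← Measure.addHaar_closedBall_center μ ((1 - l) • y + l • z), ← setLIntegral_const]
    refine (setLIntegral_mono_ae' Metric.isClosed_closedBall.measurableSet
      (ae_of_all _ fun w hw => ?_)).trans ((setLIntegral_le_lintegral _ _).trans hInt)
    obtain ⟨x, hx, rfl⟩ := exists_eq_combination_of_mem_closedBall hl hw
    exact ofReal_exp_le_coe_iff.2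
      (coe_combination_le_logFun hf hp (hq x hx) (sub_pos.2 hl1) hl (by ring))
  have hreal : Real.exp (m + Real.log V.toReal) ≤ 1 := by
    have := ENNReal.toReal_mono ENNReal.one_ne_top hmass
    rwa [ENNReal.toReal_mul, ENNReal.toReal_ofReal (Real.exp_pos _).le, ENNReal.toReal_one,
      ← Real.exp_log (ENNReal.toReal_pos hV0.ne' hVt), ← Real.exp_add] at this
  exact Real.exp_le_one_iff.1 hreal

lemma exists_closedBall_coe_le_logFun (hf : IsExtConcave (logFun f)) (h : ∫⁻ x, f x ∂μ ≠ 0) :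
    ∃ (z : E) (ρ q : ℝ), 0 < ρ ∧ ∀ x ∈ Metric.closedBall z ρ, (q : EReal) ≤ logFun f x := by
  obtain ⟨n, hn⟩ : ∃ n : ℕ, μ {x | ((-n : ℝ) : EReal) ≤ logFun f x} ≠ 0 := by
    by_contra! hnull
    refine h (lintegral_eq_zero_of_ae_eq_zero ?_)
    filter_upwards [measure_eq_zero_iff_ae_notMem.1 (measure_iUnion_null hnull)] with x hx
    by_contra hne
    simp only [mem_iUnion, mem_ofPred_eq, not_exists, not_le] at hx
    obtain ⟨n, hn⟩ := exists_nat_gt (-(logFun f x).toReal)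
    refine (hx n).not_ge ?_
    rw [← EReal.coe_toReal (logFun_ne_top f x) (by simpa [logFun] using hne)]
    exact EReal.coe_le_coe_iff.2 (neg_lt.1 hn).le
  obtain ⟨z, hz⟩ := interior_nonempty_of_measure_ne_zero μ (convex_coe_le_logFun hf _) hn
  obtain ⟨r, hr, hball⟩ := Metric.nhds_basis_closedBall.mem_iff.1 (mem_interior_iff_mem_nhds.1 hz)
  exact ⟨z, r, -n, hr, fun x hx => hball hx⟩

lemma exists_logFun_le (hf : IsExtConcave (logFun f)) (hInt : ∫⁻ x, f x ∂μ = 1) :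
    ∃ B : ℝ, ∀ x, logFun f x ≤ B := by
  obtain ⟨z, ρ, q, hρ, hq⟩ := exists_closedBall_coe_le_logFun hf (hInt.trans_ne one_ne_zero)
  refine ⟨-q - 2 * Real.log (μ.real (Metric.closedBall (0 : E) (1 / 2 * ρ))), fun y =>
    EReal.ge_of_forall_gt_iff_ge.1 fun p hp => EReal.coe_le_coe_iff.2 ?_⟩
  linarith [combination_add_log_measureReal_le_zero hf hInt.le hρ one_half_pos one_half_lt_one
    hp.le hq]

end Peak

section Bounds

variable {d : ℕ} {P : Measure (EuclideanSpace ℝ (Fin d))}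

lemma MemPd.affineSpan_support_eq_top (hP : MemPd P) : affineSpan ℝ P.support = ⊤ := by
  have := hP.isProbabilityMeasure
  by_contra h
  obtain ⟨v, hv, c, hc⟩ := exists_subset_hyperplane_of_affineSpan_ne_top
    (Measure.nonempty_support (IsProbabilityMeasure.ne_zero P)) h
  have hsupp : P P.support = 1 :=
    (prob_compl_eq_zero_iff Measure.isClosed_support.measurableSet).1 Measure.measure_compl_support
  exact (hsupp.symm.le.trans (measure_mono hc)).not_gt (hP.hyperplane v hv c)

lemma MemPd.exists_closedBall_le (hP : MemPd P) :
    ∃ (z : EuclideanSpace ℝ (Fin d)) (ρ ε : ℝ), 0 < ρ ∧ 0 < ε ∧ ε ≤ 1 ∧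
      ∀ u, IsConvexLsc u → ∀ c : ℝ, 0 ≤ c → ∫⁻ x, u x ∂P ≤ ENNReal.ofReal c →
        ∀ x ∈ Metric.closedBall z ρ, u x ≤ ENNReal.ofReal ((c + 1) / ε) := by
  have := hP.isProbabilityMeasure
  obtain ⟨z, ρ, η, hρ, hη, hball⟩ :=
    exists_closedBall_subset_of_measure_compl_lt hP.affineSpan_support_eq_top
  obtain ⟨ε, hε0, hε⟩ := ENNReal.lt_iff_exists_nnreal_btwn.1 (lt_min hη zero_lt_one)
  have hε0' : (0 : ℝ) < ε := by simpa using hε0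
  refine ⟨z, ρ, ε, hρ, hε0', mod_cast (hε.trans_le (min_le_right _ _)).le,
    fun u hu c hc hInt => ?_⟩
  refine hball {x | u x ≤ ENNReal.ofReal ((c + 1) / ε)} (hu.convex_le _) (hu.isClosed_le _)
    (lt_of_not_ge fun hle => ?_)
  have hmarkov : ENNReal.ofReal ((c + 1) / ε) * ε ≤ ENNReal.ofReal c := by
    refine le_trans ?_ ((mul_meas_ge_le_lintegral hu.measurable
      (ENNReal.ofReal ((c + 1) / ε))).trans hInt)
    gcongr
    exact (hε.le.trans (min_le_left _ _)).trans (hle.trans (measure_mono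
      fun x (hx : ¬u x ≤ ENNReal.ofReal ((c + 1) / ε)) => (not_le.1 hx).le))
  rw [← ENNReal.ofReal_coe_nnreal, ← ENNReal.ofReal_mul (by positivity),
    div_mul_cancel₀ _ hε0'.ne', ENNReal.ofReal_le_ofReal_iff hc] at hmarkov
  linarith

lemma MemPd.lintegral_expNeg_ne_zero (hP : MemPd P) {u : EuclideanSpace ℝ (Fin d) → ℝ≥0∞}
    (hu : IsConvexLsc u) (hInt : ∫⁻ x, u x ∂P ≠ ∞) : ∫⁻ x, expNeg (u x) ≠ 0 := by
  obtain ⟨z, ρ, ε, hρ, -, -, hball⟩ := hP.exists_closedBall_le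
  have hle := hball u hu _ ENNReal.toReal_nonneg (ENNReal.ofReal_toReal hInt).ge
  refine (lt_of_lt_of_le ?_ (setLIntegral_le_lintegral (Metric.closedBall z ρ) _)).ne'
  refine lt_of_lt_of_le ?_ (setLIntegral_mono_ae' Metric.isClosed_closedBall.measurableSet
    (ae_of_all _ fun x hx => expNeg_antitone (hle x hx)))
  rw [setLIntegral_const]
  exact ENNReal.mul_pos (by simp [expNeg_eq_zero]) (Metric.measure_closedBall_pos _ _ hρ).ne'

lemma IsLogConcaveDensity.exists_logFun_le {f : EuclideanSpace ℝ (Fin d) → ℝ≥0}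
    (hf : IsLogConcaveDensity f) : ∃ B : ℝ, ∀ x, logFun f x ≤ B :=
  LogConcaveProjection.exists_logFun_le hf.logConcave hf.lintegral_eq_one

lemma IsLogConcaveDensity.exists_logFun_le_and_lt {f : EuclideanSpace ℝ (Fin d) → ℝ≥0}
    (hf : IsLogConcaveDensity f) :
    ∃ b : ℝ, (∀ x, logFun f x ≤ b) ∧ ∃ y, ((b - 1 : ℝ) : EReal) < logFun f y := by
  obtain ⟨B, hB⟩ := hf.exists_logFun_le
  obtain ⟨x₀, hx₀⟩ : ∃ x, f x ≠ 0 := by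
    by_contra! hzero
    simpa [hzero] using hf.lintegral_eq_one
  have htop : ⨆ x, logFun f x ≠ ⊤ := ((iSup_le hB).trans_lt (EReal.coe_lt_top B)).ne
  have hbot : ⨆ x, logFun f x ≠ ⊥ :=
    ((bot_lt_iff_ne_bot.2 (by simpa [logFun] using hx₀)).trans_le (le_iSup (logFun f) x₀)).ne'
  lift ⨆ x, logFun f x to ℝ using ⟨htop, hbot⟩ with b hb
  refine ⟨b, fun x => hb ▸ le_iSup (logFun f) x, lt_iSup_iff.1 ?_⟩
  rw [← hb]
  exact_mod_cast sub_one_lt b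

/- Let `b` be the supremum of `log f`. Markov's inequality bounds `log f` below by
`b - (b - L + 1) / ε` on a ball that depends only on `P`; averaging with weight `ε / 2` against a
near-maximum of `log f`, this costs only half of `b`, and the other half is bounded by volume. -/
lemma MemPd.exists_uniform_bound (hP : MemPd P) (L : ℝ) :
    ∃ B : ℝ, ∀ f, IsLogConcaveDensity f → (L : EReal) ≤ extIntegral P (logFun f) →
      ∀ x, logFun f x ≤ B := by
  have := hP.isProbabilityMeasure
  obtain ⟨z, ρ, ε, hρ, hε, hε1, hball⟩ := hP.exists_closedBall_le
  set V := volume.real (Metric.closedBall (0 : EuclideanSpace ℝ (Fin d)) (ε / 2 * ρ))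
  refine ⟨3 - L - 2 * Real.log V, fun f hf hL x => ?_⟩
  obtain ⟨b, hb, y, hy⟩ := hf.exists_logFun_le_and_lt
  rw [hf.extIntegral_logFun_eq hb, coe_le_coe_sub_coe_iff] at hL
  have hs : 0 ≤ (b - L + 1) / ε := div_nonneg (by linarith [hL.1]) hε.le
  have hlow : ∀ x ∈ Metric.closedBall z ρ, ((b - (b - L + 1) / ε : ℝ) : EReal) ≤ logFun f x :=
    fun x hx => le_logFun_of_exponent_le hs (hb x)
      (hball _ (hf.isConvexLsc_exponent b) _ (sub_nonneg.2 hL.1) hL.2 x hx)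
  have hpeak := combination_add_log_measureReal_le_zero hf.logConcave hf.lintegral_eq_one.le hρ
    (half_pos hε) (by linarith) hy.le hlow
  have hcost : ε / 2 * (b - (b - L + 1) / ε) = ε / 2 * b - (b - L + 1) / 2 := by
    field_simp
  refine (hb x).trans (EReal.coe_le_coe_iff.2 ?_)
  rw [hcost] at hpeak
  linarith

end Bounds

section Hull

variable {E : Type*} [NormedAddCommGroup E] [NormedSpace ℝ E] {w : E → ℝ≥0∞}

lemma convexOn_nnreal_univ_of_forall_lt
    (h : ∀ x y : E, ∀ a b : ℝ, 0 < a → 0 < b → a + b = 1 → ∀ p q : ℝ≥0∞, w x < p → w y < q →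
      w (a • x + b • y) ≤ ENNReal.ofReal a * p + ENNReal.ofReal b * q) : ConvexOn ℝ≥0 univ w := by
  refine convexOn_nnreal_univ_iff.2 fun x y a b ha hb hab => ?_
  rcases eq_or_ne (w x) ∞ with hx | hx
  · simp [hx, ha]
  rcases eq_or_ne (w y) ∞ with hy | hy
  · simp [hy, hb]
  refine ENNReal.le_of_forall_pos_le_add fun e he _ => ?_
  have he' : (e : ℝ≥0∞) ≠ 0 := by simpa using he.ne'
  refine (h x y a b ha hb hab _ _ (ENNReal.lt_add_right hx he')
    (ENNReal.lt_add_right hy he')).trans_eq ?_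
  rw [mul_add, mul_add, add_add_add_comm, ← add_mul, ← ENNReal.ofReal_add ha.le hb.le, hab,
    ENNReal.ofReal_one, one_mul]

lemma convexOn_limsup {u : ℕ → E → ℝ≥0∞} (hu : ∀ n, ConvexOn ℝ≥0 univ (u n)) :
    ConvexOn ℝ≥0 univ fun x => limsup (fun n => u n x) atTop := by
  refine convexOn_nnreal_univ_of_forall_lt fun x y a b ha hb hab p q hp hq => ?_
  refine limsup_le_of_le (by isBoundedDefault) ?_
  filter_upwards [eventually_lt_of_limsup_lt hp, eventually_lt_of_limsup_lt hq] with n hnp hnq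
  refine (convexOn_nnreal_univ_iff.1 (hu n) x y a b ha hb hab).trans ?_
  gcongr

/-- The lower semicontinuous hull of `w`: the largest lower semicontinuous function below `w`. -/
noncomputable def lscHull {X : Type*} [TopologicalSpace X] (w : X → ℝ≥0∞) (x : X) : ℝ≥0∞ :=
  liminf w (𝓝 x)

lemma lowerSemicontinuous_lscHull {X : Type*} [TopologicalSpace X] (w : X → ℝ≥0∞) :
    LowerSemicontinuous (lscHull w) := by
  intro x c hc
  obtain ⟨c', hcc', hc'⟩ := exists_between hc
  filter_upwards [eventually_eventually_nhds.2 (eventually_lt_of_lt_liminf hc')] with y hy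
  exact hcc'.trans_le (le_liminf_of_le (by isBoundedDefault) (hy.mono fun _ => le_of_lt))

lemma lscHull_le {X : Type*} [TopologicalSpace X] (w : X → ℝ≥0∞) (x : X) : lscHull w x ≤ w x :=
  liminf_le_of_frequently_le (fun h => h.self_of_nhds le_rfl) (by isBoundedDefault)

lemma isConvexLsc_lscHull (hw : ConvexOn ℝ≥0 univ w) : IsConvexLsc (lscHull w) where
  lowerSemicontinuous := lowerSemicontinuous_lscHull w
  convexOn := by
    refine convexOn_nnreal_univ_of_forall_lt fun x y a b ha hb hab p q hp hq => ?_
    have hcomb : Tendsto (fun r : E × E => a • r.1 + b • r.2) (𝓝 x ×ˢ 𝓝 y)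
        (𝓝 (a • x + b • y)) := by
      rw [← nhds_prod_eq]
      exact Continuous.tendsto (by fun_prop) (x, y)
    have hfreq : ∃ᶠ r in 𝓝 x ×ˢ 𝓝 y, w r.1 < p ∧ w r.2 < q := frequently_prod_and.2
      ⟨frequently_lt_of_liminf_lt (by isBoundedDefault) hp,
        frequently_lt_of_liminf_lt (by isBoundedDefault) hq⟩
    refine liminf_le_of_frequently_le (hcomb.frequently (hfreq.mono fun r hr => ?_))
      (by isBoundedDefault)
    refine (convexOn_nnreal_univ_iff.1 hw r.1 r.2 a b ha hb hab).trans ?_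
    gcongr
    exacts [hr.1.le, hr.2.le]

lemma convexOn_toReal (hw : ConvexOn ℝ≥0 univ w) :
    ConvexOn ℝ {x | w x < ∞} fun x => (w x).toReal := by
  rw [convexOn_iff_forall_pos, convex_iff_forall_pos]
  have hle := convexOn_nnreal_univ_iff.1 hw
  have hlt {x y : E} (hx : w x < ∞) (hy : w y < ∞) (a b : ℝ) :
      ENNReal.ofReal a * w x + ENNReal.ofReal b * w y < ∞ := by finiteness
  refine ⟨fun x hx y hy a b ha hb hab => (hle x y a b ha hb hab).trans_lt (hlt hx hy a b),
    fun x hx y hy a b ha hb hab => ?_⟩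
  simp only [mem_ofPred_eq] at hx hy
  have hreal := ENNReal.toReal_mono (hlt hx hy a b).ne (hle x y a b ha hb hab)
  rw [ENNReal.toReal_add (by finiteness) (by finiteness)] at hreal
  simpa [ha.le, hb.le] using hreal

variable [FiniteDimensional ℝ E]

lemma continuousAt_of_notMem_frontier (hw : ConvexOn ℝ≥0 univ w) {x : E}
    (hx : x ∉ frontier {x | w x < ∞}) : ContinuousAt w x := by
  by_cases hint : x ∈ interior {x | w x < ∞}
  · have hreal : ContinuousAt (fun x => (w x).toReal) x :=
      (convexOn_toReal hw).continuousOn_interior.continuousAt (isOpen_interior.mem_nhds hint)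
    refine (ENNReal.continuous_ofReal.continuousAt.comp hreal).congr ?_
    filter_upwards [mem_interior_iff_mem_nhds.1 hint] with y hy
    exact ENNReal.ofReal_toReal (ne_of_lt hy)
  · have hcl : x ∈ (closure {x | w x < ∞})ᶜ := fun hmem => hx ⟨hmem, hint⟩
    refine (continuousAt_const (y := ∞)).congr ?_
    filter_upwards [isClosed_closure.isOpen_compl.mem_nhds hcl] with y hy
    by_contra hne
    exact hy (subset_closure (lt_top_iff_ne_top.2 (Ne.symm hne)))

lemma lscHull_ae_eq [MeasurableSpace E] [BorelSpace E] (μ : Measure E) [μ.IsAddHaarMeasure]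
    (hw : ConvexOn ℝ≥0 univ w) : lscHull w =ᵐ[μ] w := by
  filter_upwards [measure_eq_zero_iff_ae_notMem.1 ((convexOn_toReal hw).1.addHaar_frontier μ)]
    with x hx
  exact (continuousAt_of_notMem_frontier hw hx).liminf_eq

end Hull

section Limit

variable {E : Type*} [NormedAddCommGroup E] [NormedSpace ℝ E] {u : ℕ → E → ℝ≥0∞}

lemma liminf_le_of_mem_closedBall (hu : ∀ n, IsConvexLsc (u n)) {x y z : E} {ρ l : ℝ} {s : ℝ≥0∞}
    (hs : ∀ n, ∀ x ∈ Metric.closedBall z ρ, u n x ≤ s) (hl : 0 < l) (hl1 : l < 1)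
    (hy : y ∈ Metric.closedBall ((1 - l) • x + l • z) (l * ρ)) :
    liminf (fun n => u n y) atTop ≤
      ENNReal.ofReal (1 - l) * liminf (fun n => u n x) atTop + ENNReal.ofReal l * s := by
  obtain ⟨x', hx', rfl⟩ := exists_eq_combination_of_mem_closedBall hl hy
  have hmono : Monotone fun t : ℝ≥0∞ => ENNReal.ofReal (1 - l) * t + ENNReal.ofReal l * s :=
    fun t t' htt' => by dsimp only; gcongr
  have hcont : Continuous fun t : ℝ≥0∞ => ENNReal.ofReal (1 - l) * t + ENNReal.ofReal l * s :=
    (ENNReal.continuous_const_mul ENNReal.ofReal_ne_top).add continuous_const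
  rw [hmono.map_liminf_of_continuousAt _ hcont.continuousAt]
  refine liminf_le_liminf (.of_forall fun n => ?_)
  refine ((hu n).le_of_add_eq_one x x' (sub_pos.2 hl1) hl (by ring)).trans ?_
  dsimp only [Function.comp_apply]
  gcongr
  exact hs n x' hx'

lemma dist_le_of_mem_closedBall {x y z : E} {ρ l : ℝ} (hl : 0 ≤ l)
    (hy : y ∈ Metric.closedBall ((1 - l) • x + l • z) (l * ρ)) :
    dist y x ≤ l * (ρ + ‖z - x‖) := by
  calc dist y x ≤ dist y ((1 - l) • x + l • z) + dist ((1 - l) • x + l • z) x :=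
        dist_triangle _ _ _
    _ ≤ l * ρ + l * ‖z - x‖ := by
        refine add_le_add hy (le_of_eq ?_)
        rw [dist_eq_norm, show (1 - l) • x + l • z - x = l • (z - x) by module, norm_smul,
          Real.norm_of_nonneg hl]
    _ = l * (ρ + ‖z - x‖) := by ring

/- Approach `x` along points `y l` of the dense set that lie in the balls
`(1 - l) x + l (closedBall z ρ)`, where convexity bounds the limit by
`(1 - l) liminf u n x + l s`. -/
lemma lscHull_limsup_le_liminf (hu : ∀ n, IsConvexLsc (u n)) {z : E} {ρ : ℝ} (hρ : 0 < ρ)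
    {s : ℝ≥0∞} (hst : s ≠ ∞) (hs : ∀ n, ∀ x ∈ Metric.closedBall z ρ, u n x ≤ s)
    (hlim : Dense {x | ∃ a, Tendsto (fun n => u n x) atTop (𝓝 a)}) (x : E) :
    lscHull (fun x => limsup (fun n => u n x) atTop) x ≤ liminf (fun n => u n x) atTop := by
  have hmem (l : ℝ) (hl : 0 < l) : ∃ y ∈ Metric.closedBall ((1 - l) • x + l • z) (l * ρ),
      ∃ a, Tendsto (fun n => u n y) atTop (𝓝 a) := by
    obtain ⟨y, hy, hya⟩ := hlim.exists_mem_open Metric.isOpen_ball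
      (Metric.nonempty_ball (x := (1 - l) • x + l • z).2 (mul_pos hl hρ))
    exact ⟨y, Metric.ball_subset_closedBall hya, hy⟩
  choose! y hy hya using hmem
  have hyx : Tendsto y (𝓝[>] 0) (𝓝 x) := by
    refine tendsto_iff_dist_tendsto_zero.2 (squeeze_zero' (.of_forall fun _ => dist_nonneg)
      (eventually_mem_nhdsWithin.mono fun l hl => dist_le_of_mem_closedBall hl.le (hy l hl)) ?_)
    exact tendsto_nhdsWithin_of_tendsto_nhds
      (Continuous.tendsto' (by fun_prop) _ _ (by simp))
  have hbound : Tendsto (fun l => ENNReal.ofReal (1 - l) * liminf (fun n => u n x) atTop +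
      ENNReal.ofReal l * s) (𝓝[>] 0) (𝓝 (liminf (fun n => u n x) atTop)) := by
    refine tendsto_nhdsWithin_of_tendsto_nhds ?_
    have hone : Tendsto (fun l => ENNReal.ofReal (1 - l)) (𝓝 0) (𝓝 1) :=
      (ENNReal.continuous_ofReal.comp (continuous_const.sub continuous_id)).tendsto' _ _ (by simp)
    have hzero : Tendsto ENNReal.ofReal (𝓝 0) (𝓝 0) :=
      ENNReal.continuous_ofReal.tendsto' _ _ (by simp)
    simpa using (ENNReal.Tendsto.mul_const hone (.inl one_ne_zero)).add
      (ENNReal.Tendsto.mul_const hzero (.inr hst))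
  rw [← hbound.liminf_eq]
  refine (liminf_le_liminf_of_le hyx).trans ?_
  rw [← liminf_comp]
  refine liminf_le_liminf ?_
  filter_upwards [Ioo_mem_nhdsGT (zero_lt_one' ℝ)] with l hl
  obtain ⟨a, ha⟩ := hya l hl.1
  rw [Function.comp_apply, ha.limsup_eq, ← ha.liminf_eq]
  exact liminf_le_of_mem_closedBall hu hs hl.1 hl.2 (hy l hl.1)

lemma lintegral_expNeg_lscHull_limsup_le [FiniteDimensional ℝ E] [MeasurableSpace E] [BorelSpace E]
    (μ : Measure E) [μ.IsAddHaarMeasure] (hu : ∀ n, IsConvexLsc (u n)) :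
    ∫⁻ x, expNeg (lscHull (fun x => limsup (fun n => u n x) atTop) x) ∂μ ≤
      liminf (fun n => ∫⁻ x, expNeg (u n x) ∂μ) atTop := by
  refine le_trans (le_of_eq (lintegral_congr_ae ?_))
    (lintegral_liminf_le fun n => continuous_expNeg.measurable.comp (hu n).measurable)
  filter_upwards [lscHull_ae_eq μ (convexOn_limsup fun n => (hu n).convexOn)] with x hx
  rw [hx]
  exact expNeg_antitone.map_limsup_of_continuousAt _ continuous_expNeg.continuousAt

end Limit

section Hellinger

/-- The square root `exp (-u / 2)` of `exp (-u)`, as a real number. -/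
noncomputable def sqrtExpNeg (u : ℝ≥0∞) : ℝ := (expNeg (2⁻¹ * u)).toReal

lemma measurable_sqrtExpNeg : Measurable sqrtExpNeg :=
  (continuous_expNeg.measurable.comp (measurable_const_mul _)).ennreal_toReal

lemma inv_two_mul_add_inv_two_mul (u : ℝ≥0∞) : 2⁻¹ * u + 2⁻¹ * u = u := by
  rw [← add_mul, ENNReal.inv_two_add_inv_two, one_mul]

lemma enorm_sqrtExpNeg_sub_sq_add (u v : ℝ≥0∞) :
    ‖sqrtExpNeg u - sqrtExpNeg v‖ₑ ^ 2 + 2 * expNeg (2⁻¹ * (u + v)) = expNeg u + expNeg v := by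
  have hsq (w : ℝ≥0∞) : expNeg w = expNeg (2⁻¹ * w) * expNeg (2⁻¹ * w) := by
    rw [← expNeg_add, inv_two_mul_add_inv_two_mul]
  rw [mul_add, expNeg_add, hsq u, hsq v, sqrtExpNeg, sqrtExpNeg]
  generalize hp : expNeg (2⁻¹ * u) = p
  generalize hq : expNeg (2⁻¹ * v) = q
  lift p to ℝ≥0 using hp ▸ expNeg_ne_top _
  lift q to ℝ≥0 using hq ▸ expNeg_ne_top _
  have hnorm : ‖(p : ℝ) - q‖₊ ^ 2 + 2 * (p * q) = p * p + q * q := by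
    apply NNReal.eq
    push_cast [coe_nnnorm, Real.norm_eq_abs, sq_abs]
    ring
  rw [ENNReal.coe_toReal, ENNReal.coe_toReal, enorm_eq_nnnorm]
  exact_mod_cast congrArg ((↑) : ℝ≥0 → ℝ≥0∞) hnorm

lemma eLpNorm_sqrtExpNeg_sub_sq_add {Ω : Type*} [MeasurableSpace Ω] {μ : Measure Ω}
    {u v : Ω → ℝ≥0∞} (hu : Measurable u) (hv : Measurable v) :
    eLpNorm ((fun x => sqrtExpNeg (u x)) - fun x => sqrtExpNeg (v x)) 2 μ ^ 2 +
        2 * ∫⁻ x, expNeg (2⁻¹ * (u x + v x)) ∂μ =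
      ∫⁻ x, expNeg (u x) ∂μ + ∫⁻ x, expNeg (v x) ∂μ := by
  have hnorm := eLpNorm_nnreal_pow_eq_lintegral (μ := μ) (p := 2) two_ne_zero
    (f := (fun x => sqrtExpNeg (u x)) - fun x => sqrtExpNeg (v x))
  simp only [NNReal.coe_ofNat, ENNReal.coe_ofNat, ENNReal.rpow_ofNat, Pi.sub_apply] at hnorm
  have hmid : Measurable fun x => expNeg (2⁻¹ * (u x + v x)) :=
    continuous_expNeg.measurable.comp ((hu.add hv).const_mul _)
  have hexp : Measurable fun x => expNeg (u x) := continuous_expNeg.measurable.comp hu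
  rw [hnorm, ← lintegral_const_mul _ hmid, ← lintegral_add_right _ (hmid.const_mul 2),
    ← lintegral_add_left hexp]
  exact lintegral_congr fun x => enorm_sqrtExpNeg_sub_sq_add (u x) (v x)

lemma exists_tendsto_of_tendsto_sqrtExpNeg {ι : Type*} {F : Filter ι} {u : ι → ℝ≥0∞} {l : ℝ}
    (h : Tendsto (fun n => sqrtExpNeg (u n)) F (𝓝 l)) : ∃ a, Tendsto u F (𝓝 a) := by
  have hinv (w : ℝ≥0∞) : (-ENNReal.log (ENNReal.ofReal (sqrtExpNeg w))).toENNReal = 2⁻¹ * w := by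
    rw [sqrtExpNeg, ENNReal.ofReal_toReal (expNeg_ne_top _), expNeg, EReal.log_exp, neg_neg,
      EReal.toENNReal_coe]
  have hcont : Continuous fun t : ℝ => (-ENNReal.log (ENNReal.ofReal t)).toENNReal :=
    EReal.continuous_toENNReal.comp (continuous_neg.comp
      (ENNReal.continuous_log.comp ENNReal.continuous_ofReal))
  have hhalf : Tendsto (fun n => 2⁻¹ * u n) F (𝓝 (-ENNReal.log (ENNReal.ofReal l)).toENNReal) :=
    ((hcont.tendsto l).comp h).congr fun n => hinv (u n)
  exact ⟨_, (hhalf.add hhalf).congr fun n => inv_two_mul_add_inv_two_mul (u n)⟩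

end Hellinger

section Integrability

lemma pow_mul_exp_neg_le {a : ℝ} (ha : 0 < a) (k n : ℕ) {t : ℝ} (ht : 0 ≤ t) :
    t ^ k * Real.exp (-(a * t)) ≤
      (k + n).factorial * Real.exp a / a ^ (k + n) * (1 + t) ^ (-(n : ℝ)) := by
  have hexp := Real.pow_div_factorial_le_exp (a * (1 + t)) (by positivity) (k + n)
  have hpow : t ^ k ≤ (1 + t) ^ k := by gcongr; linarith
  rw [Real.rpow_neg (by positivity), Real.rpow_natCast, Real.exp_neg]
  rw [mul_pow, mul_add, mul_one, Real.exp_add, div_le_iff₀ (by positivity)] at hexp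
  calc t ^ k * (Real.exp (a * t))⁻¹ ≤ (1 + t) ^ k * (Real.exp (a * t))⁻¹ := by gcongr
    _ = a ^ (k + n) * (1 + t) ^ (k + n) *
          (a ^ (k + n) * (1 + t) ^ n * Real.exp (a * t))⁻¹ := by field_simp; ring
    _ ≤ Real.exp a * Real.exp (a * t) * (k + n).factorial *
          (a ^ (k + n) * (1 + t) ^ n * Real.exp (a * t))⁻¹ := by gcongr
    _ = (k + n).factorial * Real.exp a / a ^ (k + n) * ((1 + t) ^ n)⁻¹ := by field_simp

lemma integrable_norm_pow_mul_exp_neg {E : Type*} [NormedAddCommGroup E] [NormedSpace ℝ E]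
    [FiniteDimensional ℝ E] [MeasurableSpace E] [BorelSpace E] (μ : Measure E)
    [μ.IsAddHaarMeasure] {a : ℝ} (ha : 0 < a) (k : ℕ) :
    Integrable (fun x : E => ‖x‖ ^ k * Real.exp (-(a * ‖x‖))) μ := by
  have hdecay : Integrable (fun x : E => (1 + ‖x‖) ^ (-((Module.finrank ℝ E + 1 : ℕ) : ℝ))) μ :=
    integrable_one_add_norm (by simp)
  refine (hdecay.const_mul ((k + (Module.finrank ℝ E + 1)).factorial * Real.exp a /
    a ^ (k + (Module.finrank ℝ E + 1)))).mono' (Continuous.aestronglyMeasurable (by fun_prop))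
    (.of_forall fun x => ?_)
  rw [Real.norm_of_nonneg (by positivity)]
  exact pow_mul_exp_neg_le ha k _ (norm_nonneg x)

end Integrability

section Existence

variable {d : ℕ} {P : Measure (EuclideanSpace ℝ (Fin d))}

lemma MemPd.exists_extIntegral_ge (hP : MemPd P) :
    ∃ (L : ℝ) (g : EuclideanSpace ℝ (Fin d) → ℝ≥0),
      IsLogConcaveDensity g ∧ (L : EReal) ≤ extIntegral P (logFun g) := by
  have := hP.isProbabilityMeasure
  have htop : ∫⁻ x : EuclideanSpace ℝ (Fin d), expNeg ‖x‖ₑ ≠ ∞ := by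
    have hint := integrable_norm_pow_mul_exp_neg (volume : Measure (EuclideanSpace ℝ (Fin d)))
      one_pos 0
    convert hint.lintegral_lt_top.ne using 4 with x
    rw [← ofReal_norm, expNeg_ofReal (norm_nonneg x), pow_zero, one_mul, one_mul]
  obtain ⟨g, hg, hgL⟩ := isConvexLsc_enorm.exists_isLogConcaveDensity_extIntegral_eq (P := P)
    (hP.lintegral_expNeg_ne_zero isConvexLsc_enorm hP.firstMoment.ne) htop
  refine ⟨-Real.log (∫⁻ x : EuclideanSpace ℝ (Fin d), expNeg ‖x‖ₑ).toReal -
    (∫⁻ x, ‖x‖ₑ ∂P).toReal, g, hg, ?_⟩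
  rw [hgL, EReal.coe_sub, EReal.coe_ennreal_toReal hP.firstMoment.ne]

lemma MemPd.exists_isLUB_extIntegral (hP : MemPd P) :
    ∃ M : ℝ, IsLUB {t | ∃ g, IsLogConcaveDensity g ∧ extIntegral P (logFun g) = t} (M : EReal) := by
  have := hP.isProbabilityMeasure
  obtain ⟨L, g₀, hg₀, hL⟩ := hP.exists_extIntegral_ge
  obtain ⟨B, hB⟩ := hP.exists_uniform_bound L
  have hlub := isLUB_sSup {t | ∃ g, IsLogConcaveDensity g ∧ extIntegral P (logFun g) = t}
  have hbot := ((EReal.bot_lt_coe L).trans_le (hL.trans (hlub.1 ⟨g₀, hg₀, rfl⟩))).ne'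
  have htop : sSup {t | ∃ g, IsLogConcaveDensity g ∧ extIntegral P (logFun g) = t} ≠ ⊤ := by
    refine ((hlub.2 ?_).trans_lt (EReal.coe_lt_top (max B L))).ne
    rintro _ ⟨g, hg, rfl⟩
    rcases le_total (L : EReal) (extIntegral P (logFun g)) with hgL | hgL
    · rw [hg.extIntegral_logFun_eq (hB g hg hgL)]
      refine (EReal.sub_le_sub le_rfl (EReal.coe_ennreal_nonneg _)).trans ?_
      simp
    · exact hgL.trans (by simp)
  exact ⟨_, (EReal.coe_toReal htop hbot).symm ▸ hlub⟩

/-- The functions `exp (B - u n)` are log-concave densities whose objective values `∫ log f dP`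
approach the supremum `M` over all log-concave densities, with error at most `(1 / 4) ^ n`. -/
structure IsMaximizingSeq (P : Measure (EuclideanSpace ℝ (Fin d))) (B M : ℝ)
    (u : ℕ → EuclideanSpace ℝ (Fin d) → ℝ≥0∞) : Prop where
  extIntegral_le : ∀ g, IsLogConcaveDensity g → extIntegral P (logFun g) ≤ M
  isConvexLsc : ∀ n, IsConvexLsc (u n)
  lintegral_expNeg : ∀ n, ∫⁻ x, expNeg (u n x) = ENNReal.ofReal (Real.exp (-B))
  le : M ≤ B
  lintegral_le : ∀ n, ∫⁻ x, u n x ∂P ≤ ENNReal.ofReal (B - M + (1 / 4) ^ n)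

lemma MemPd.exists_isMaximizingSeq (hP : MemPd P) : ∃ B M u, IsMaximizingSeq P B M u := by
  have := hP.isProbabilityMeasure
  obtain ⟨M, hM⟩ := hP.exists_isLUB_extIntegral
  obtain ⟨B, hB⟩ := hP.exists_uniform_bound (M - 1)
  have hnear (n : ℕ) : ∃ g, IsLogConcaveDensity g ∧
      ((M - (1 / 4) ^ n : ℝ) : EReal) ≤ extIntegral P (logFun g) := by
    have hlt : ((M - (1 / 4) ^ n : ℝ) : EReal) < M :=
      EReal.coe_lt_coe_iff.2 (sub_lt_self _ (by positivity))
    obtain ⟨_, ⟨g, hg, rfl⟩, hgM⟩ := (lt_isLUB_iff hM).1 hlt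
    exact ⟨g, hg, hgM.le⟩
  choose f hf hfM using hnear
  have hfB (n : ℕ) (x) : logFun (f n) x ≤ B := by
    refine hB _ (hf n) ((EReal.coe_le_coe_iff.2 ?_).trans (hfM n)) x
    linarith [pow_le_one₀ (n := n) (show (0 : ℝ) ≤ 1 / 4 by norm_num) (by norm_num)]
  have hval (n : ℕ) := coe_le_coe_sub_coe_iff.1
    ((hfM n).trans_eq ((hf n).extIntegral_logFun_eq (hfB n)))
  refine ⟨B, M, fun n => exponent B (f n), fun g hg => hM.1 ⟨g, hg, rfl⟩,
    fun n => (hf n).isConvexLsc_exponent B, fun n => (hf n).lintegral_expNeg_exponent (hfB n), ?_,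
    fun n => (hval n).2.trans_eq (by ring_nf)⟩
  have hlim : Tendsto (fun n : ℕ => M - (1 / 4 : ℝ) ^ n) atTop (𝓝 (M - 0)) :=
    tendsto_const_nhds.sub (tendsto_pow_atTop_nhds_zero_of_lt_one (by norm_num) (by norm_num))
  exact (sub_zero M).symm.trans_le (le_of_tendsto' hlim fun n => (hval n).1)

end Existence

section Maximizer

variable {d : ℕ} {P : Measure (EuclideanSpace ℝ (Fin d))} {B M : ℝ}

lemma MemPd.ofReal_exp_le_lintegral_expNeg (hP : MemPd P)
    (hM : ∀ g, IsLogConcaveDensity g → extIntegral P (logFun g) ≤ M)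
    {v : EuclideanSpace ℝ (Fin d) → ℝ≥0∞} (hv : IsConvexLsc v) {c : ℝ} (hc : 0 ≤ c)
    (hvc : ∫⁻ x, v x ∂P ≤ ENNReal.ofReal c) :
    ENNReal.ofReal (Real.exp (-(M + c))) ≤ ∫⁻ x, expNeg (v x) := by
  have := hP.isProbabilityMeasure
  rcases eq_or_ne (∫⁻ x, expNeg (v x)) ∞ with htop | htop
  · exact htop ▸ le_top
  have h0 := hP.lintegral_expNeg_ne_zero hv (hvc.trans_lt ENNReal.ofReal_lt_top).ne
  obtain ⟨g, hg, hgv⟩ := hv.exists_isLogConcaveDensity_extIntegral_eq (P := P) h0 htop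
  have hle := (EReal.sub_le_sub le_rfl (EReal.coe_ennreal_le_coe_ennreal_iff.2 hvc)).trans
    (hgv.symm.trans_le (hM g hg))
  rw [EReal.coe_ennreal_ofReal, max_eq_left hc, ← EReal.coe_sub, EReal.coe_le_coe_iff] at hle
  rw [ENNReal.ofReal_le_iff_le_toReal htop, ← Real.le_log_iff_exp_le (ENNReal.toReal_pos h0 htop)]
  linarith

lemma MemPd.exists_isLogConcaveDensity_le_extIntegral (hP : MemPd P)
    {v : EuclideanSpace ℝ (Fin d) → ℝ≥0∞} (hv : IsConvexLsc v) (hMB : M ≤ B)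
    (hvP : ∫⁻ x, v x ∂P ≤ ENNReal.ofReal (B - M))
    (hexp : ∫⁻ x, expNeg (v x) ≤ ENNReal.ofReal (Real.exp (-B))) :
    ∃ g, IsLogConcaveDensity g ∧ (M : EReal) ≤ extIntegral P (logFun g) := by
  have := hP.isProbabilityMeasure
  have h0 := hP.lintegral_expNeg_ne_zero hv (hvP.trans_lt ENNReal.ofReal_lt_top).ne
  have htop := (hexp.trans_lt ENNReal.ofReal_lt_top).ne
  obtain ⟨g, hg, hgv⟩ := hv.exists_isLogConcaveDensity_extIntegral_eq (P := P) h0 htop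
  have hlog : B ≤ -Real.log (∫⁻ x, expNeg (v x)).toReal := by
    rw [le_neg, Real.log_le_iff_le_exp (ENNReal.toReal_pos h0 htop)]
    exact ENNReal.toReal_le_of_le_ofReal (Real.exp_pos _).le hexp
  refine ⟨g, hg, hgv ▸ coe_le_coe_sub_coe_iff.2 ⟨?_, hvP.trans ?_⟩⟩
  · exact hMB.trans hlog
  · gcongr

namespace IsMaximizingSeq

variable {u : ℕ → EuclideanSpace ℝ (Fin d) → ℝ≥0∞}

lemma lintegral_le_of_le (hu : IsMaximizingSeq P B M u) {N n : ℕ} (hn : N ≤ n) :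
    ∫⁻ x, u n x ∂P ≤ ENNReal.ofReal (B - M + (1 / 4) ^ N) := by
  refine (hu.lintegral_le n).trans (ENNReal.ofReal_le_ofReal ?_)
  gcongr B - M + ?_
  exact pow_le_pow_of_le_one (by norm_num) (by norm_num) hn

lemma ofReal_mul_le_lintegral_expNeg_midpoint (hP : MemPd P) (hu : IsMaximizingSeq P B M u)
    {N n m : ℕ} (hn : N ≤ n) (hm : N ≤ m) :
    ENNReal.ofReal (Real.exp (-B) * (1 - (1 / 4) ^ N)) ≤
      ∫⁻ x, expNeg (2⁻¹ * (u n x + u m x)) := by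
  have hmean : ∫⁻ x, 2⁻¹ * (u n x + u m x) ∂P ≤ ENNReal.ofReal (B - M + (1 / 4) ^ N) := by
    rw [lintegral_const_mul' _ _ (by finiteness), lintegral_add_left (hu.isConvexLsc n).measurable,
      ← inv_two_mul_add_inv_two_mul (ENNReal.ofReal _), ← mul_add]
    gcongr
    exacts [hu.lintegral_le_of_le hn, hu.lintegral_le_of_le hm]
  refine le_trans (ENNReal.ofReal_le_ofReal ?_) (hP.ofReal_exp_le_lintegral_expNeg hu.extIntegral_le
    (((hu.isConvexLsc n).add (hu.isConvexLsc m)).const_mul (by finiteness))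
    (add_nonneg (sub_nonneg.2 hu.le) (by positivity)) hmean)
  calc Real.exp (-B) * (1 - (1 / 4) ^ N) ≤ Real.exp (-B) * Real.exp (-(1 / 4) ^ N) := by
        gcongr
        exact Real.one_sub_le_exp_neg _
    _ = Real.exp (-(M + (B - M + (1 / 4) ^ N))) := by rw [← Real.exp_add]; ring_nf

lemma eLpNorm_sqrtExpNeg_sub_lt (hP : MemPd P) (hu : IsMaximizingSeq P B M u)
    {N n m : ℕ} (hn : N ≤ n) (hm : N ≤ m) :
    eLpNorm ((fun x => sqrtExpNeg (u n x)) - fun x => sqrtExpNeg (u m x)) 2 volume <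
      ENNReal.ofReal (2 * Real.sqrt (Real.exp (-B)) * (1 / 2) ^ N) := by
  have hmeas (k : ℕ) := (hu.isConvexLsc k).measurable
  have hid := eLpNorm_sqrtExpNeg_sub_sq_add (μ := volume) (hmeas n) (hmeas m)
  rw [hu.lintegral_expNeg, hu.lintegral_expNeg] at hid
  have hδ : (1 / 4 : ℝ) ^ N ≤ 1 := pow_le_one₀ (by norm_num) (by norm_num)
  have hpow : ((1 / 2 : ℝ) ^ N) ^ 2 = (1 / 4) ^ N := by
    rw [← pow_mul, mul_comm, pow_mul]
    norm_num
  have hsq : eLpNorm ((fun x => sqrtExpNeg (u n x)) - fun x => sqrtExpNeg (u m x)) 2 volume ^ 2 ≤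
      ENNReal.ofReal (2 * Real.exp (-B) * (1 / 4) ^ N) := by
    calc _ ≤ ENNReal.ofReal (Real.exp (-B)) + ENNReal.ofReal (Real.exp (-B)) -
            2 * ENNReal.ofReal (Real.exp (-B) * (1 - (1 / 4) ^ N)) := by
          refine ENNReal.le_sub_of_add_le_right (by finiteness) (hid ▸ ?_)
          gcongr
          exact hu.ofReal_mul_le_lintegral_expNeg_midpoint hP hn hm
      _ = ENNReal.ofReal (2 * Real.exp (-B) * (1 / 4) ^ N) := by
          rw [← ENNReal.ofReal_add (by positivity) (by positivity), ← ENNReal.ofReal_ofNat 2,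
            ← ENNReal.ofReal_mul zero_le_two, ← ENNReal.ofReal_sub _
              (mul_nonneg zero_le_two (mul_nonneg (by positivity) (sub_nonneg.2 hδ)))]
          ring_nf
  refine (ENNReal.pow_lt_pow_left_iff two_ne_zero).1 (hsq.trans_lt ?_)
  rw [← ENNReal.ofReal_pow (by positivity), ENNReal.ofReal_lt_ofReal_iff (by positivity), mul_pow,
    mul_pow, Real.sq_sqrt (by positivity), hpow]
  gcongr
  norm_num

lemma ae_exists_tendsto (hP : MemPd P) (hu : IsMaximizingSeq P B M u) :
    ∀ᵐ x, ∃ a, Tendsto (fun n => u n x) atTop (𝓝 a) := by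
  have hlim : ∀ᵐ x, ∃ l, Tendsto (fun n => sqrtExpNeg (u n x)) atTop (𝓝 l) := by
    refine Lp.ae_tendsto_of_cauchy_eLpNorm (p := 2) (f := fun n x => sqrtExpNeg (u n x))
      (fun n => (measurable_sqrtExpNeg.comp (hu.isConvexLsc n).measurable).aestronglyMeasurable)
      (by norm_num) ?_ fun N n m hn hm => hu.eLpNorm_sqrtExpNeg_sub_lt hP hn hm
    exact ((summable_geometric_of_lt_one (by norm_num) (by norm_num)).mul_left _).tsum_ofReal_ne_top
  filter_upwards [hlim] with x ⟨l, hl⟩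
  exact exists_tendsto_of_tendsto_sqrtExpNeg hl

lemma lscHull_limsup_le_liminf (hP : MemPd P) (hu : IsMaximizingSeq P B M u)
    (x : EuclideanSpace ℝ (Fin d)) :
    lscHull (fun x => limsup (fun n => u n x) atTop) x ≤ liminf (fun n => u n x) atTop := by
  obtain ⟨z, ρ, ε, hρ, -, -, hball⟩ := hP.exists_closedBall_le
  have hle (n : ℕ) : ∫⁻ x, u n x ∂P ≤ ENNReal.ofReal (B - M + 1) := by
    simpa using hu.lintegral_le_of_le n.zero_le
  exact LogConcaveProjection.lscHull_limsup_le_liminf hu.isConvexLsc hρ ENNReal.ofReal_ne_top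
    (fun n => hball _ (hu.isConvexLsc n) _ (by linarith [hu.le]) (hle n))
    (Measure.dense_of_ae (hu.ae_exists_tendsto hP)) x

lemma lintegral_liminf_le (hu : IsMaximizingSeq P B M u) :
    ∫⁻ x, liminf (fun n => u n x) atTop ∂P ≤ ENNReal.ofReal (B - M) := by
  have hlim : Tendsto (fun n : ℕ => ENNReal.ofReal (B - M + (1 / 4) ^ n)) atTop
      (𝓝 (ENNReal.ofReal (B - M + 0))) :=
    (ENNReal.continuous_ofReal.tendsto _).comp (tendsto_const_nhds.add
      (tendsto_pow_atTop_nhds_zero_of_lt_one (by norm_num) (by norm_num)))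
  calc ∫⁻ x, liminf (fun n => u n x) atTop ∂P
      ≤ liminf (fun n => ∫⁻ x, u n x ∂P) atTop :=
        MeasureTheory.lintegral_liminf_le fun n => (hu.isConvexLsc n).measurable
    _ ≤ liminf (fun n : ℕ => ENNReal.ofReal (B - M + (1 / 4) ^ n)) atTop :=
        liminf_le_liminf (.of_forall hu.lintegral_le)
    _ = ENNReal.ofReal (B - M) := by rw [hlim.liminf_eq, add_zero]

end IsMaximizingSeq

theorem MemPd.exists_isProjection (hP : MemPd P) : ∃ f, IsProjection P f := by
  obtain ⟨B, M, u, hu⟩ := hP.exists_isMaximizingSeq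
  have hexp := lintegral_expNeg_lscHull_limsup_le volume hu.isConvexLsc
  simp only [hu.lintegral_expNeg, liminf_const] at hexp
  obtain ⟨f, hf, hfM⟩ := hP.exists_isLogConcaveDensity_le_extIntegral
    (isConvexLsc_lscHull (convexOn_limsup fun n => (hu.isConvexLsc n).convexOn)) hu.le
    ((lintegral_mono (hu.lscHull_limsup_le_liminf hP)).trans hu.lintegral_liminf_le) hexp
  exact ⟨f, hf, fun g hg => (hu.extIntegral_le g hg).trans hfM⟩

end Maximizer

section Optimality

lemma expNeg_add_mul_expNeg_le_one (s : ℝ≥0∞) : expNeg s + s * expNeg s ≤ 1 := by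
  rcases eq_or_ne s ∞ with rfl | hs
  · simp [expNeg_eq_zero.2 rfl]
  lift s to ℝ≥0 using hs
  rw [← ENNReal.ofReal_coe_nnreal, expNeg_ofReal s.coe_nonneg, ← ENNReal.ofReal_mul s.coe_nonneg,
    ← ENNReal.ofReal_add (by positivity) (by positivity), ENNReal.ofReal_le_one, Real.exp_neg,
    ← one_add_mul, ← div_eq_mul_inv, div_le_one (Real.exp_pos _), add_comm]
  exact Real.add_one_le_exp _

lemma one_sub_expNeg_le (s : ℝ≥0∞) : 1 - expNeg s ≤ s := by
  rcases eq_or_ne s ∞ with rfl | hs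
  · exact le_top
  lift s to ℝ≥0 using hs
  rw [tsub_le_iff_right, ← ENNReal.ofReal_coe_nnreal, expNeg_ofReal s.coe_nonneg,
    ← ENNReal.ofReal_add s.coe_nonneg (by positivity), ENNReal.one_le_ofReal]
  linarith [Real.one_sub_le_exp_neg s]

lemma le_liminf_mul_one_sub_expNeg (a : ℝ≥0∞) :
    a ≤ liminf (fun n : ℕ => (n : ℝ≥0∞) * (1 - expNeg ((n : ℝ≥0∞)⁻¹ * a))) atTop := by
  rcases eq_or_ne a ∞ with rfl | ha
  · simpa [ENNReal.mul_top, expNeg_eq_zero.2 rfl] using ENNReal.tendsto_nat_nhds_top.liminf_eq.ge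
  have hzero : Tendsto (fun n : ℕ => (n : ℝ≥0∞)⁻¹ * a) atTop (𝓝 0) := by
    simpa using ENNReal.Tendsto.mul_const ENNReal.tendsto_inv_nat_nhds_zero (.inr ha)
  have hlim : Tendsto (fun n : ℕ => a * expNeg ((n : ℝ≥0∞)⁻¹ * a)) atTop (𝓝 a) := by
    simpa [expNeg_zero] using
      ENNReal.Tendsto.const_mul ((continuous_expNeg.tendsto _).comp hzero) (.inr ha)
  refine hlim.liminf_eq.ge.trans (liminf_le_liminf ?_)
  filter_upwards [eventually_ne_atTop 0] with n hn
  calc a * expNeg ((n : ℝ≥0∞)⁻¹ * a)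
      = n * ((n : ℝ≥0∞)⁻¹ * a * expNeg ((n : ℝ≥0∞)⁻¹ * a)) := by
        rw [← mul_assoc, ← mul_assoc, ENNReal.mul_inv_cancel (by simpa) (by simp), one_mul]
    _ ≤ n * (1 - expNeg ((n : ℝ≥0∞)⁻¹ * a)) := by
        gcongr
        exact ENNReal.le_sub_of_add_le_left (expNeg_ne_top _) (expNeg_add_mul_expNeg_le_one _)

lemma lintegral_le_of_forall_expNeg_le {Ω : Type*} [MeasurableSpace Ω]
    {μ : Measure Ω} [IsProbabilityMeasure μ] {H : Ω → ℝ≥0∞} (hH : Measurable H) {a : ℝ≥0∞}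
    (h : ∀ c : ℝ≥0∞, c ≠ ∞ → expNeg (c * a) ≤ ∫⁻ x, expNeg (c * H x) ∂μ) :
    ∫⁻ x, H x ∂μ ≤ a := by
  have hmeas (c : ℝ≥0∞) : Measurable fun x => expNeg (c * H x) :=
    continuous_expNeg.measurable.comp (hH.const_mul c)
  have hone (c : ℝ≥0∞) (hc : c ≠ ∞) : ∫⁻ x, 1 - expNeg (c * H x) ∂μ ≤ c * a := by
    rw [lintegral_sub (hmeas c) ?_ (ae_of_all _ fun x => expNeg_le_one _), lintegral_one,
      measure_univ]
    · exact (tsub_le_tsub_left (h c hc) 1).trans (one_sub_expNeg_le _)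
    · refine ((lintegral_mono fun x => expNeg_le_one _).trans_lt ?_).ne
      simp
  calc ∫⁻ x, H x ∂μ
      ≤ ∫⁻ x, liminf (fun n : ℕ => (n : ℝ≥0∞) * (1 - expNeg ((n : ℝ≥0∞)⁻¹ * H x))) atTop ∂μ :=
        lintegral_mono fun x => le_liminf_mul_one_sub_expNeg (H x)
    _ ≤ liminf (fun n : ℕ => ∫⁻ x, n * (1 - expNeg ((n : ℝ≥0∞)⁻¹ * H x)) ∂μ) atTop :=
        lintegral_liminf_le fun n => ((hmeas _).const_sub 1).const_mul _
    _ ≤ liminf (fun _ : ℕ => a) atTop := by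
        refine liminf_le_liminf ?_
        filter_upwards [eventually_ne_atTop 0] with n hn
        rw [lintegral_const_mul' _ _ (by finiteness)]
        calc (n : ℝ≥0∞) * ∫⁻ x, 1 - expNeg ((n : ℝ≥0∞)⁻¹ * H x) ∂μ
            ≤ n * ((n : ℝ≥0∞)⁻¹ * a) := by
              gcongr
              exact hone _ (by simpa)
          _ = a := by rw [← mul_assoc, ENNReal.mul_inv_cancel (by simpa) (by simp), one_mul]
    _ = a := liminf_const a

variable {d : ℕ} {P : Measure (EuclideanSpace ℝ (Fin d))}
  {f : EuclideanSpace ℝ (Fin d) → ℝ≥0} {H : EuclideanSpace ℝ (Fin d) → ℝ≥0∞}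

lemma IsLogConcaveDensity.measurable (hf : IsLogConcaveDensity f) :
    Measurable fun x => (f x : ℝ≥0∞) :=
  hf.upperSemicontinuous.measurable.coe_nnreal_ennreal

lemma IsLogConcaveDensity.isProbabilityMeasure (hf : IsLogConcaveDensity f) :
    IsProbabilityMeasure (densityMeasure f) :=
  ⟨by rw [densityMeasure, withDensity_apply _ .univ, Measure.restrict_univ, hf.lintegral_eq_one]⟩

lemma IsLogConcaveDensity.lintegral_expNeg_exponent_add (hf : IsLogConcaveDensity f) {B : ℝ}
    (hB : ∀ x, logFun f x ≤ B) (hH : Measurable H) :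
    ∫⁻ x, expNeg (exponent B f x + H x) =
      ENNReal.ofReal (Real.exp (-B)) * ∫⁻ x, expNeg (H x) ∂(densityMeasure f) := by
  have hexp : Measurable fun x => expNeg (H x) := continuous_expNeg.measurable.comp hH
  rw [densityMeasure, lintegral_withDensity_eq_lintegral_mul _ hf.measurable hexp,
    ← lintegral_const_mul' _ _ ENNReal.ofReal_ne_top]
  refine lintegral_congr fun x => ?_
  rw [Pi.mul_apply, expNeg_add, coe_eq_exp_mul_expNeg (logFun_eq_sub_exponent (hB x)),
    ← mul_assoc, ← mul_assoc, mul_comm (ENNReal.ofReal _), ofReal_exp_mul_ofReal_exp_neg, one_mul]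

lemma IsProjection.expNeg_lintegral_le (hP : MemPd P) (hf : IsProjection P f)
    (hH : IsConvexLsc H) :
    expNeg (∫⁻ x, H x ∂P) ≤ ∫⁻ x, expNeg (H x) ∂(densityMeasure f) := by
  have := hP.isProbabilityMeasure
  rcases eq_or_ne (∫⁻ x, H x ∂P) ∞ with hI | hI
  · simp [hI, expNeg_eq_zero.2 rfl]
  obtain ⟨B, hB⟩ := hf.1.exists_logFun_le
  obtain ⟨L, g, hg, hL⟩ := hP.exists_extIntegral_ge
  have hu := hf.1.isConvexLsc_exponent B
  have hfB := hf.1.extIntegral_logFun_eq (P := P) hB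
  have hJ : ∫⁻ x, exponent B f x ∂P ≠ ∞ :=
    ((coe_le_coe_sub_coe_iff.1 (hL.trans ((hf.2 g hg).trans_eq hfB))).2.trans_lt
      ENNReal.ofReal_lt_top).ne
  have hmax (g) (hg : IsLogConcaveDensity g) :
      extIntegral P (logFun g) ≤ (B - (∫⁻ x, exponent B f x ∂P).toReal : ℝ) := by
    rw [EReal.coe_sub, EReal.coe_ennreal_toReal hJ, ← hfB]
    exact hf.2 g hg
  have hle := hP.ofReal_exp_le_lintegral_expNeg hmax (hu.add hH) ENNReal.toReal_nonneg
    (ENNReal.ofReal_toReal (by rw [lintegral_add_left hu.measurable]; finiteness)).ge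
  rw [hf.1.lintegral_expNeg_exponent_add hB hH.measurable, lintegral_add_left hu.measurable,
    ENNReal.toReal_add hJ hI, ← add_assoc, sub_add_cancel, neg_add, Real.exp_add,
    ENNReal.ofReal_mul (Real.exp_pos _).le, ← expNeg_ofReal ENNReal.toReal_nonneg,
    ENNReal.ofReal_toReal hI] at hle
  exact (ENNReal.mul_le_mul_iff_right (by positivity) ENNReal.ofReal_ne_top).1 hle

theorem IsProjection.lintegral_le (hP : MemPd P) (hf : IsProjection P f) (hH : IsConvexLsc H) :
    ∫⁻ x, H x ∂(densityMeasure f) ≤ ∫⁻ x, H x ∂P := by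
  have := hf.1.isProbabilityMeasure
  refine lintegral_le_of_forall_expNeg_le hH.measurable fun c hc => ?_
  rw [← lintegral_const_mul' c H hc]
  exact hf.expNeg_lintegral_le hP (hH.const_mul hc)

end Optimality

section Mean

lemma tendsto_integral_max_neg {Ω : Type*} [MeasurableSpace Ω] {μ : Measure Ω} {φ : Ω → ℝ}
    (hφ : Integrable φ μ) :
    Tendsto (fun n : ℕ => ∫ x, max (φ x) (-n) ∂μ) atTop (𝓝 (∫ x, φ x ∂μ)) := by
  refine tendsto_integral_of_dominated_convergence (fun x => ‖φ x‖)
    (fun n => hφ.aestronglyMeasurable.sup aestronglyMeasurable_const) hφ.norm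
    (fun n => ae_of_all _ fun x => ?_) (ae_of_all _ fun x => tendsto_const_nhds.congr' ?_)
  · rw [Real.norm_eq_abs, Real.norm_eq_abs, abs_le]
    exact ⟨(neg_abs_le _).trans (le_max_left _ _),
      max_le (le_abs_self _) ((neg_nonpos.2 n.cast_nonneg).trans (abs_nonneg _))⟩
  · filter_upwards [eventually_ge_atTop ⌈-φ x⌉₊] with n hn
    exact (max_eq_left (neg_le.1 (Nat.ceil_le.1 hn))).symm

lemma integral_max_neg {Ω : Type*} [MeasurableSpace Ω] {μ : Measure Ω} [IsProbabilityMeasure μ]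
    {φ : Ω → ℝ} (hφ : Integrable φ μ) (c : ℝ) :
    ∫ x, max (φ x) (-c) ∂μ = (∫⁻ x, ENNReal.ofReal (φ x + c) ∂μ).toReal - c := by
  have hadd : Integrable (fun x => φ x + c) μ := hφ.add (integrable_const c)
  have hmax (x : Ω) : max (φ x) (-c) = max (φ x + c) 0 - c := by
    rw [← max_sub_sub_right, add_sub_cancel_right, zero_sub]
  have hpos : ∫ x, max (φ x + c) 0 ∂μ = (∫⁻ x, ENNReal.ofReal (φ x + c) ∂μ).toReal := by
    rw [integral_eq_lintegral_of_nonneg_ae (ae_of_all _ fun x => le_max_right (φ x + c) 0)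
      hadd.pos_part.aestronglyMeasurable]
    simp only [ENNReal.ofReal_max, ENNReal.ofReal_zero, max_eq_left (zero_le (α := ℝ≥0∞))]
  simp_rw [hmax]
  rw [integral_sub hadd.pos_part (integrable_const c), integral_const, probReal_univ, one_smul,
    hpos]

variable {d : ℕ} {P : Measure (EuclideanSpace ℝ (Fin d))}
  {f : EuclideanSpace ℝ (Fin d) → ℝ≥0}

lemma MemPd.integrable_id (hP : MemPd P) : Integrable (fun x => x) P :=
  ⟨measurable_id.aestronglyMeasurable, hP.firstMoment⟩

namespace IsProjection

lemma integrable_id (hP : MemPd P) (hf : IsProjection P f) :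
    Integrable (fun x => x) (densityMeasure f) :=
  ⟨measurable_id.aestronglyMeasurable,
    (hf.lintegral_le hP isConvexLsc_enorm).trans_lt hP.firstMoment⟩

lemma integral_clm_le (hP : MemPd P) (hf : IsProjection P f)
    (l : EuclideanSpace ℝ (Fin d) →L[ℝ] ℝ) :
    ∫ x, l x ∂(densityMeasure f) ≤ ∫ x, l x ∂P := by
  have := hP.isProbabilityMeasure
  have := hf.1.isProbabilityMeasure
  have hlf := l.integrable_comp (hf.integrable_id hP)
  have hlP := l.integrable_comp hP.integrable_id
  refine le_of_tendsto_of_tendsto' (tendsto_integral_max_neg hlf) (tendsto_integral_max_neg hlP)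
    fun n => ?_
  rw [integral_max_neg hlf, integral_max_neg hlP]
  refine sub_le_sub_right (ENNReal.toReal_mono ?_ ?_) _
  · exact (hlP.add (integrable_const (n : ℝ))).lintegral_lt_top.ne
  · exact hf.lintegral_le hP (isConvexLsc_ofReal (by fun_prop)
      (((l : EuclideanSpace ℝ (Fin d) →ₗ[ℝ] ℝ).convexOn convex_univ).add_const n))

lemma integral_clm_eq (hP : MemPd P) (hf : IsProjection P f)
    (l : EuclideanSpace ℝ (Fin d) →L[ℝ] ℝ) :
    ∫ x, l x ∂(densityMeasure f) = ∫ x, l x ∂P := by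
  refine le_antisymm (hf.integral_clm_le hP l) ?_
  simpa only [neg_apply, integral_neg, neg_le_neg_iff] using hf.integral_clm_le hP (-l)

theorem integral_id_eq (hP : MemPd P) (hf : IsProjection P f) :
    ∫ x, x ∂(densityMeasure f) = ∫ x, x ∂P := by
  refine ext_inner_left ℝ fun v => ?_
  have heq := hf.integral_clm_eq hP (innerSL ℝ v)
  rwa [(innerSL ℝ v).integral_comp_comm (hf.integrable_id hP),
    (innerSL ℝ v).integral_comp_comm hP.integrable_id] at heq

end IsProjection

end Mean

section AffineMinorant

variable {V : Type*} [NormedAddCommGroup V] [NormedSpace ℝ V] {h : V → EReal}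

lemma IsExtConvex.convexOn_toReal (hh : IsExtConvex h) :
    ConvexOn ℝ {x | h x < ⊤} fun x => (h x).toReal := by
  have hle (x) (hx : h x < ⊤) (y) (hy : h y < ⊤) (a b : ℝ) (ha : 0 < a) (hb : 0 < b)
      (hab : a + b = 1) :
      h (a • x + b • y) ≤ ((a * (h x).toReal + b * (h y).toReal : ℝ) : EReal) := by
    rw [EReal.coe_add, EReal.coe_mul, EReal.coe_mul, EReal.coe_toReal hx.ne (hh.1 x),
      EReal.coe_toReal hy.ne (hh.1 y)]
    exact hh.2 x y a b ha hb hab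
  refine convexOn_iff_forall_pos.2 ⟨convex_iff_forall_pos.2 ?_, ?_⟩
  · exact fun x hx y hy a b ha hb hab =>
      (hle x hx y hy a b ha hb hab).trans_lt (EReal.coe_lt_top _)
  · exact fun x hx y hy a b ha hb hab =>
      EReal.toReal_le_toReal (hle x hx y hy a b ha hb hab) (hh.1 _) (EReal.coe_ne_top _)

variable [FiniteDimensional ℝ V]

lemma exists_clm_add_le_of_mem_interior {D : Set V} {g : V → ℝ} (hg : ConvexOn ℝ D g) {x₀ : V}
    (hx₀ : x₀ ∈ interior D) : ∃ (l : V →L[ℝ] ℝ) (c : ℝ), ∀ x ∈ D, l x + c ≤ g x := by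
  have hcont : ContinuousAt g x₀ :=
    hg.continuousOn_interior.continuousAt (isOpen_interior.mem_nhds hx₀)
  obtain ⟨r, hr, hball⟩ := Metric.eventually_nhds_iff_ball.1
    (hcont.eventually_const_lt (sub_one_lt (g x₀)))
  set U : Set (V × ℝ) := Metric.ball x₀ r ×ˢ Iio (g x₀ - 1)
  have hUconvex : Convex ℝ U := (convex_ball x₀ r).prod (convex_Iio _)
  have hUopen : IsOpen U := Metric.isOpen_ball.prod isOpen_Iio
  have hdisj : Disjoint U {p : V × ℝ | p.1 ∈ D ∧ g p.1 < p.2} :=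
    Set.disjoint_left.2 fun p hp hp' => ((hball p.1 hp.1).trans hp'.2).not_gt hp.2
  obtain ⟨F, s, hFlt, hFge⟩ :=
    geometric_hahn_banach_open hUconvex hUopen hg.convex_strict_epigraph hdisj
  have hsplit (x : V) (t : ℝ) : F (x, t) = F (x, 0) + t * F (0, 1) := by
    rw [← smul_eq_mul, ← map_smul, ← map_add]
    simp
  have hpos : 0 < F (0, 1) := by
    have hlow := hFlt (x₀, g x₀ - 2) ⟨Metric.mem_ball_self hr, by simp⟩
    have hupp := hFge (x₀, g x₀ + 1) ⟨interior_subset hx₀, by simp⟩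
    rw [hsplit] at hlow hupp
    linarith
  refine ⟨-(F (0, 1))⁻¹ • F.comp (.inl ℝ V ℝ), s / F (0, 1),
    fun x hx => le_of_forall_gt_imp_ge_of_dense fun t ht => ?_⟩
  have hxt := hFge (x, t) ⟨hx, ht⟩
  rw [hsplit] at hxt
  have hval : (-(F (0, 1))⁻¹ • F.comp (.inl ℝ V ℝ)) x + s / F (0, 1) =
      (s - F (x, 0)) / F (0, 1) := by
    simp
    ring
  rw [hval, div_le_iff₀ hpos]
  linarith

lemma exists_clm_add_le {D : Set V} {g : V → ℝ} (hg : ConvexOn ℝ D g) :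
    ∃ (l : V →L[ℝ] ℝ) (c : ℝ), ∀ x ∈ D, l x + c ≤ g x := by
  rcases D.eq_empty_or_nonempty with rfl | ⟨x₀, hx₀⟩
  · exact ⟨0, 0, by simp⟩
  set W := Submodule.span ℝ ((fun w => x₀ + w) ⁻¹' D)
  let A : W →ᵃ[ℝ] V := AffineMap.const ℝ W x₀ + W.subtype.toAffineMap
  have hA (w : W) : A w = x₀ + w := rfl
  have hgA := hg.comp_affineMap A
  have h0 : (0 : W) ∈ A ⁻¹' D := by simpa [hA] using hx₀
  have hne : (interior (A ⁻¹' D)).Nonempty := by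
    rw [hgA.1.interior_nonempty_iff_affineSpan_eq_top,
      AffineSubspace.affineSpan_eq_top_iff_vectorSpan_eq_top_of_nonempty ℝ _ _ ⟨0, h0⟩, eq_top_iff,
      ← Submodule.span_span_coe_preimage (R := ℝ) (s := (fun w => x₀ + w) ⁻¹' D),
      Submodule.span_le]
    intro w hw
    simpa using vsub_mem_vectorSpan ℝ (show w ∈ A ⁻¹' D from hw) h0
  obtain ⟨w₀, hw₀⟩ := hne
  obtain ⟨l, c, hlc⟩ := exists_clm_add_le_of_mem_interior hgA hw₀
  obtain ⟨L, hL⟩ := LinearMap.exists_extend (l : W →ₗ[ℝ] ℝ)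
  refine ⟨L.toContinuousLinearMap, c - L x₀, fun x hx => ?_⟩
  have hxW : x - x₀ ∈ W := Submodule.subset_span (by simpa using hx)
  have hle := hlc ⟨x - x₀, hxW⟩ (by simpa [hA] using hx)
  have hLl : L (x - x₀) = l ⟨x - x₀, hxW⟩ := LinearMap.congr_fun hL ⟨x - x₀, hxW⟩
  rw [← hLl, map_sub, Function.comp_apply, hA, add_sub_cancel] at hle
  rw [LinearMap.coe_toContinuousLinearMap']
  linarith

lemma IsExtConvex.exists_clm_add_le (hh : IsExtConvex h) :
    ∃ (l : V →L[ℝ] ℝ) (c : ℝ), ∀ x, ((l x + c : ℝ) : EReal) ≤ h x := by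
  obtain ⟨l, c, hlc⟩ := LogConcaveProjection.exists_clm_add_le hh.convexOn_toReal
  refine ⟨l, c, fun x => ?_⟩
  rcases eq_or_ne (h x) ⊤ with hx | hx
  · exact hx ▸ le_top
  · rw [← EReal.coe_toReal hx (hh.1 x)]
    exact EReal.coe_le_coe_iff.2 (hlc x hx.lt_top)

lemma IsExtConvex.lintegral_neg_lt_top [MeasurableSpace V] {Q : Measure V} [IsFiniteMeasure Q]
    (hQ : Integrable (fun x => x) Q) (hh : IsExtConvex h) :
    ∫⁻ x, (-h x).toENNReal ∂Q < ∞ := by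
  obtain ⟨l, c, hlc⟩ := hh.exists_clm_add_le
  have hint : Integrable (fun x => -(l x + c)) Q :=
    ((l.integrable_comp hQ).add (integrable_const c)).neg
  refine (lintegral_mono fun x => ?_).trans_lt hint.lintegral_lt_top
  rw [← EReal.real_coe_toENNReal, EReal.coe_neg]
  exact EReal.toENNReal_le_toENNReal (EReal.neg_le_neg_iff.2 (hlc x))

end AffineMinorant

section ConvexOrder

lemma convexOn_toENNReal_sub_clm {V : Type*} [NormedAddCommGroup V] [NormedSpace ℝ V]
    {h : V → EReal} (hh : IsExtConvex h) {l : V →L[ℝ] ℝ} {c : ℝ}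
    (hlc : ∀ x, ((l x + c : ℝ) : EReal) ≤ h x) :
    ConvexOn ℝ≥0 univ fun x => (h x - (l x + c : ℝ)).toENNReal := by
  refine convexOn_nnreal_univ_iff.2 fun x y a b ha hb hab => ?_
  rcases eq_or_ne (h x) ⊤ with hx | hx
  · simp only [hx, EReal.top_sub_coe, EReal.toENNReal_top,
      ENNReal.mul_top (ENNReal.ofReal_pos.2 ha).ne', top_add, le_top]
  rcases eq_or_ne (h y) ⊤ with hy | hy
  · simp only [hy, EReal.top_sub_coe, EReal.toENNReal_top,
      ENNReal.mul_top (ENNReal.ofReal_pos.2 hb).ne', add_top, le_top]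
  have hlcx := hlc x
  have hlcy := hlc y
  have hle := hh.2 x y a b ha hb hab
  lift h x to ℝ using ⟨hx, hh.1 x⟩ with p
  lift h y to ℝ using ⟨hy, hh.1 y⟩ with q
  have hp : 0 ≤ p - (l x + c) := sub_nonneg.2 (EReal.coe_le_coe_iff.1 hlcx)
  have hq : 0 ≤ q - (l y + c) := sub_nonneg.2 (EReal.coe_le_coe_iff.1 hlcy)
  have hl : a * p + b * q - (l (a • x + b • y) + c) =
      a * (p - (l x + c)) + b * (q - (l y + c)) := by
    rw [map_add, map_smul, map_smul, smul_eq_mul, smul_eq_mul]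
    linear_combination c * hab
  calc (h (a • x + b • y) - (l (a • x + b • y) + c : ℝ)).toENNReal
      ≤ ENNReal.ofReal (a * p + b * q - (l (a • x + b • y) + c)) := by
        rw [← EReal.real_coe_toENNReal, EReal.coe_sub]
        exact EReal.toENNReal_le_toENNReal (EReal.sub_le_sub hle le_rfl)
    _ = ENNReal.ofReal a * ((p : EReal) - (l x + c : ℝ)).toENNReal +
        ENNReal.ofReal b * ((q : EReal) - (l y + c : ℝ)).toENNReal := by
        rw [hl, ← EReal.coe_sub, ← EReal.coe_sub, EReal.real_coe_toENNReal,
          EReal.real_coe_toENNReal, ENNReal.ofReal_add (by positivity) (by positivity),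
          ENNReal.ofReal_mul ha.le, ENNReal.ofReal_mul hb.le]

lemma IsExtConvex.exists_eq_clm_add {V : Type*} [NormedAddCommGroup V] [NormedSpace ℝ V]
    [FiniteDimensional ℝ V] {h : V → EReal} (hh : IsExtConvex h) :
    ∃ (l : V →L[ℝ] ℝ) (c : ℝ) (w : V → ℝ≥0∞), ConvexOn ℝ≥0 univ w ∧
      ∀ x, h x = ((l x + c : ℝ) : EReal) + w x := by
  obtain ⟨l, c, hlc⟩ := hh.exists_clm_add_le
  refine ⟨l, c, _, convexOn_toENNReal_sub_clm hh hlc, fun x => ?_⟩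
  rw [EReal.coe_toENNReal ((EReal.sub_nonneg (.inr (EReal.coe_ne_top _))
    (.inr (EReal.coe_ne_bot _))).2 (hlc x)), add_comm, EReal.sub_add_cancel]

variable {d : ℕ} {P : Measure (EuclideanSpace ℝ (Fin d))}
  {f : EuclideanSpace ℝ (Fin d) → ℝ≥0}

theorem IsProjection.extIntegral_le (hP : MemPd P) (hf : IsProjection P f)
    {h : EuclideanSpace ℝ (Fin d) → EReal} (hh : IsExtConvex h) :
    extIntegral (densityMeasure f) h ≤ extIntegral P h := by
  have := hP.isProbabilityMeasure
  have := hf.1.isProbabilityMeasure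
  obtain ⟨l, c, w, hw, hlw⟩ := hh.exists_eq_clm_add
  have hH := isConvexLsc_lscHull hw
  have hl : Measurable fun x => l x + c := by fun_prop
  have hlf := l.integrable_comp (hf.integrable_id hP)
  have hlP := l.integrable_comp hP.integrable_id
  have hmean : ∫ x, l x + c ∂(densityMeasure f) = ∫ x, l x + c ∂P := by
    rw [integral_add hlf (integrable_const c), integral_add hlP (integrable_const c),
      hf.integral_clm_eq hP, integral_const, integral_const, probReal_univ, probReal_univ]
  -- `f` has a Lebesgue density, so its mass ignores the null set where `w` is not lower
  -- semicontinuous; for `P` the pointwise inequality `lscHull w ≤ w` is enough.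
  calc extIntegral (densityMeasure f) h
      = extIntegral (densityMeasure f) fun x => ((l x + c : ℝ) : EReal) + lscHull w x := by
        refine extIntegral_congr_ae ?_
        filter_upwards [(withDensity_absolutelyContinuous volume _).ae_le
          (lscHull_ae_eq volume hw)] with x hx
        rw [hx, hlw]
    _ = ((∫ x, l x + c ∂(densityMeasure f) : ℝ) : EReal) +
          ((∫⁻ x, lscHull w x ∂(densityMeasure f) : ℝ≥0∞) : EReal) :=
        extIntegral_coe_add_coe (hlf.add (integrable_const c)) hl hH.measurable
    _ ≤ ((∫ x, l x + c ∂P : ℝ) : EReal) + ((∫⁻ x, lscHull w x ∂P : ℝ≥0∞) : EReal) := by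
        rw [hmean]
        gcongr
        exact EReal.coe_ennreal_le_coe_ennreal_iff.2 (hf.lintegral_le hP hH)
    _ = extIntegral P fun x => ((l x + c : ℝ) : EReal) + lscHull w x :=
        (extIntegral_coe_add_coe (hlP.add (integrable_const c)) hl hH.measurable).symm
    _ ≤ extIntegral P h := extIntegral_mono fun x => by
        rw [hlw]
        gcongr
        exact EReal.coe_ennreal_le_coe_ennreal_iff.2 (lscHull_le w x)

end ConvexOrder

section Tails

variable {E : Type*} [NormedAddCommGroup E] [NormedSpace ℝ E] {f : E → ℝ≥0}

lemma logFun_le_sub_norm_div (hf : IsExtConcave (logFun f)) {z : E} {q R : ℝ} (hR : 0 < R)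
    (hz : (q : EReal) ≤ logFun f z) (hq : ∀ y, ‖y - z‖ = R → logFun f y < (q - 1 : ℝ)) {x : E}
    (hx : R < ‖x - z‖) : logFun f x ≤ (q - ‖x - z‖ / R : ℝ) := by
  refine EReal.ge_of_forall_gt_iff_ge.1 fun p hp => EReal.coe_le_coe_iff.2 ?_
  have hnorm : 0 < ‖x - z‖ := hR.trans hx
  set t := R / ‖x - z‖ with ht
  have ht0 : 0 < t := by positivity
  have ht1 : t < 1 := (div_lt_one hnorm).2 hx
  have hsphere : ‖(1 - t) • z + t • x - z‖ = R := by
    rw [show (1 - t) • z + t • x - z = t • (x - z) by module, norm_smul,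
      Real.norm_of_nonneg ht0.le, ht, div_mul_cancel₀ _ hnorm.ne']
  have hlt : (1 - t) * q + t * p < q - 1 := EReal.coe_lt_coe_iff.1
    ((coe_combination_le_logFun hf hz hp.le (sub_pos.2 ht1) ht0 (by ring)).trans_lt
      (hq _ hsphere))
  rw [← inv_div, ← ht, le_sub_iff_add_le, ← mul_le_mul_iff_right₀ ht0, mul_add,
    mul_inv_cancel₀ ht0.ne']
  linarith

variable [FiniteDimensional ℝ E] [MeasurableSpace E] [BorelSpace E] {μ : Measure E}
  [μ.IsAddHaarMeasure]

/- If `x ∈ C` is far away, a ball of fixed radius around the midpoint of `x` and a fixed interior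
point lies in `C` but avoids a compact set carrying almost all of the measure of `C`. -/
lemma isBounded_of_convex_of_measure_ne_top {C : Set E} (hC : Convex ℝ C)
    (hint : (interior C).Nonempty) (hμC : μ C ≠ ∞) : Bornology.IsBounded C := by
  obtain ⟨z, hz⟩ := hint
  obtain ⟨ρ, hρ, hball⟩ :=
    Metric.nhds_basis_closedBall.mem_iff.1 (mem_interior_iff_mem_nhds.1 hz)
  obtain ⟨K, -, hK, hμK⟩ := isOpen_interior.measurableSet.exists_isCompact_sdiff_lt
    (ne_top_of_le_ne_top hμC (measure_mono interior_subset))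
    (Metric.measure_ball_pos μ (0 : E) (half_pos hρ)).ne'
  obtain ⟨R, hKR⟩ := hK.isBounded.subset_closedBall z
  refine Metric.isBounded_closedBall.subset (t := Metric.closedBall z (2 * R + ρ)) fun x hx => ?_
  by_contra hfar
  rw [mem_closedBall_iff_norm, not_le] at hfar
  set m := (1 - 1 / 2 : ℝ) • x + (1 / 2 : ℝ) • z with hm
  have hsub : Metric.ball m (ρ / 2) ⊆ interior C := by
    refine interior_maximal (fun w hw => ?_) Metric.isOpen_ball
    obtain ⟨y, hy, rfl⟩ := exists_eq_combination_of_mem_closedBall one_half_pos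
      (Metric.ball_subset_closedBall (one_div_mul_eq_div (2 : ℝ) ρ ▸ hw))
    exact hC hx (hball hy) (by norm_num) (by norm_num) (by norm_num)
  have hdisj : Disjoint (Metric.ball m (ρ / 2)) K := by
    refine disjoint_left.2 fun w hw hwK => ?_
    have hdist : dist m z = ‖x - z‖ / 2 := by
      rw [dist_eq_norm, hm, show (1 - 1 / 2 : ℝ) • x + (1 / 2 : ℝ) • z - z =
        (1 / 2 : ℝ) • (x - z) by module, norm_smul, Real.norm_of_nonneg one_half_pos.le]
      ring
    linarith [dist_triangle_left m z w, Metric.mem_ball.1 hw, Metric.mem_closedBall.1 (hKR hwK)]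
  refine hμK.not_ge ?_
  rw [← Measure.addHaar_ball_center μ m]
  exact measure_mono fun w hw => ⟨hsub hw, disjoint_left.1 hdisj hw⟩

lemma isBounded_coe_le_logFun (hf : IsExtConcave (logFun f))
    (hfm : Measurable fun x => (f x : ℝ≥0∞)) (hInt : ∫⁻ x, f x ∂μ ≠ ∞) {p : ℝ}
    (hp : (interior {x | (p : EReal) ≤ logFun f x}).Nonempty) :
    Bornology.IsBounded {x | (p : EReal) ≤ logFun f x} := by
  refine isBounded_of_convex_of_measure_ne_top (μ := μ) (convex_coe_le_logFun hf p) hp ?_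
  simp_rw [← ofReal_exp_le_coe_iff]
  exact (meas_ge_le_lintegral_div hfm.aemeasurable (ENNReal.ofReal_pos.2 (Real.exp_pos p)).ne'
    ENNReal.ofReal_ne_top).trans_lt
      (ENNReal.div_lt_top hInt (ENNReal.ofReal_pos.2 (Real.exp_pos p)).ne') |>.ne

lemma exists_logFun_le_sub_mul_norm (hf : IsExtConcave (logFun f))
    (hfm : Measurable fun x => (f x : ℝ≥0∞)) (hInt : ∫⁻ x, f x ∂μ = 1) :
    ∃ a b : ℝ, 0 < a ∧ ∀ x, logFun f x ≤ (b - a * ‖x‖ : ℝ) := by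
  obtain ⟨B, hB⟩ := exists_logFun_le hf hInt
  obtain ⟨z, ρ, q, hρ, hq⟩ := exists_closedBall_coe_le_logFun hf (hInt.trans_ne one_ne_zero)
  have hbdd : Bornology.IsBounded {x | ((q - 1 : ℝ) : EReal) ≤ logFun f x} := by
    refine isBounded_coe_le_logFun hf hfm (hInt.trans_ne ENNReal.one_ne_top) ⟨z, ?_⟩
    refine mem_interior_iff_mem_nhds.2 (mem_of_superset (Metric.closedBall_mem_nhds z hρ)
      fun x hx => (EReal.coe_le_coe_iff.2 (sub_one_lt q).le).trans (hq x hx))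
  obtain ⟨R, hR, hRC⟩ := hbdd.subset_ball_lt 0 z
  have hsphere : ∀ y, ‖y - z‖ = R → logFun f y < (q - 1 : ℝ) := fun y hy =>
    not_le.1 fun hle => (mem_ball_iff_norm.1 (hRC hle)).ne hy
  refine ⟨R⁻¹, max B q + R⁻¹ * ‖z‖ + 1, by positivity, fun x => ?_⟩
  have htri : R⁻¹ * ‖x‖ ≤ R⁻¹ * ‖x - z‖ + R⁻¹ * ‖z‖ := by
    rw [← mul_add]
    gcongr
    simpa using norm_add_le (x - z) z
  rcases le_or_gt ‖x - z‖ R with hx | hx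
  · have hnear : R⁻¹ * ‖x - z‖ ≤ 1 := by rwa [inv_mul_le_iff₀ hR, mul_one]
    exact (hB x).trans (EReal.coe_le_coe_iff.2 (by linarith [le_max_left B q]))
  · refine (logFun_le_sub_norm_div hf hR (hq z (Metric.mem_closedBall_self hρ.le)) hsphere hx).trans
      (EReal.coe_le_coe_iff.2 ?_)
    rw [div_eq_inv_mul]
    linarith [le_max_right B q]

theorem IsLogConcaveDensity.memLp_two {d : ℕ} {f : EuclideanSpace ℝ (Fin d) → ℝ≥0}
    (hf : IsLogConcaveDensity f) : MemLp (fun x => x) 2 (densityMeasure f) := by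
  obtain ⟨a, b, ha, hab⟩ :=
    exists_logFun_le_sub_mul_norm hf.logConcave hf.measurable hf.lintegral_eq_one
  refine ⟨measurable_id.aestronglyMeasurable, ?_⟩
  rw [eLpNorm_lt_top_iff_lintegral_rpow_enorm_lt_top (by norm_num) (by norm_num), densityMeasure,
    lintegral_withDensity_eq_lintegral_mul _ hf.measurable (by fun_prop)]
  refine lt_of_le_of_lt (lintegral_mono fun x => ?_)
    ((integrable_norm_pow_mul_exp_neg volume ha 2).const_mul (Real.exp b)).lintegral_lt_top
  calc (f x : ℝ≥0∞) * ‖x‖ₑ ^ (2 : ℝ≥0∞).toReal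
      ≤ ENNReal.ofReal (Real.exp (b - a * ‖x‖)) * ENNReal.ofReal (‖x‖ ^ 2) := by
        rw [ENNReal.toReal_ofNat, ENNReal.rpow_ofNat, ← ofReal_norm,
          ENNReal.ofReal_pow (norm_nonneg x)]
        gcongr
        exact coe_le_ofReal_exp_iff.2 (hab x)
    _ = ENNReal.ofReal (Real.exp b * (‖x‖ ^ 2 * Real.exp (-(a * ‖x‖)))) := by
        rw [← ENNReal.ofReal_mul (Real.exp_pos _).le, sub_eq_add_neg, Real.exp_add]
        ring_nf

end Tails

section SecondMoments

variable {d : ℕ}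

lemma IsProjection.lintegral_inner_sq_le {P : Measure (EuclideanSpace ℝ (Fin d))}
    {f : EuclideanSpace ℝ (Fin d) → ℝ≥0} (hP : MemPd P) (hf : IsProjection P f)
    (v m : EuclideanSpace ℝ (Fin d)) :
    ∫⁻ x, ENNReal.ofReal ((inner ℝ v (x - m)) ^ 2) ∂(densityMeasure f) ≤
      ∫⁻ x, ENNReal.ofReal ((inner ℝ v (x - m)) ^ 2) ∂P := by
  refine hf.lintegral_le hP (isConvexLsc_ofReal (by fun_prop) ?_)
  simp_rw [inner_sub_right]
  exact (even_two.convexOn_pow (𝕜 := ℝ)).comp_affineMap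
    ((innerₛₗ ℝ v).toAffineMap - AffineMap.const ℝ _ (inner ℝ v m))

variable {Q : Measure (EuclideanSpace ℝ (Fin d))}

lemma isHermitian_secondMomentMatrix (m : EuclideanSpace ℝ (Fin d)) :
    (secondMomentMatrix Q m).IsHermitian := by
  ext i j
  simp only [secondMomentMatrix, Matrix.conjTranspose_apply, Matrix.of_apply, star_trivial,
    mul_comm]

variable [IsFiniteMeasure Q]

lemma memLp_coord_sub (hQ : MemLp (fun x => x) 2 Q) (m : EuclideanSpace ℝ (Fin d)) (i : Fin d) :
    MemLp (fun x => x i - m i) 2 Q :=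
  (EuclideanSpace.proj (𝕜 := ℝ) i).comp_memLp' (hQ.sub (memLp_const m))

lemma memLp_inner_sub (hQ : MemLp (fun x => x) 2 Q) (v m : EuclideanSpace ℝ (Fin d)) :
    MemLp (fun x => inner ℝ v (x - m)) 2 Q :=
  (hQ.sub (memLp_const m)).const_inner v

lemma dotProduct_secondMomentMatrix_mulVec (hQ : MemLp (fun x => x) 2 Q)
    (m : EuclideanSpace ℝ (Fin d)) (w : Fin d → ℝ) :
    w ⬝ᵥ (secondMomentMatrix Q m).mulVec w =
      ∫ x, (inner ℝ (WithLp.toLp 2 w) (x - m)) ^ 2 ∂Q := by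
  have hint (i j : Fin d) : Integrable (fun x => w i * w j * ((x i - m i) * (x j - m j))) Q :=
    ((memLp_coord_sub hQ m i).integrable_mul (memLp_coord_sub hQ m j)).const_mul _
  have hexpand (x : EuclideanSpace ℝ (Fin d)) : (inner ℝ (WithLp.toLp 2 w) (x - m)) ^ 2 =
      ∑ i, ∑ j, w i * w j * ((x i - m i) * (x j - m j)) := by
    rw [PiLp.inner_apply, sq, Finset.sum_mul_sum]
    refine Finset.sum_congr rfl fun i _ => Finset.sum_congr rfl fun j _ => ?_
    simp only [PiLp.sub_apply, RCLike.inner_apply, conj_trivial]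
    ring
  simp_rw [hexpand]
  rw [integral_finsetSum _ fun i _ => integrable_finsetSum _ fun j _ => hint i j]
  simp_rw [integral_finsetSum _ fun j _ => hint _ j, integral_const_mul, dotProduct,
    Matrix.mulVec, dotProduct, Finset.mul_sum, secondMomentMatrix, Matrix.of_apply]
  exact Finset.sum_congr rfl fun i _ => Finset.sum_congr rfl fun j _ => by ring

theorem IsProjection.posSemidef_sub {P : Measure (EuclideanSpace ℝ (Fin d))}
    {f : EuclideanSpace ℝ (Fin d) → ℝ≥0} (hP : MemPd P) (hf : IsProjection P f)
    (hP2 : MemLp (fun x => x) 2 P) (m : EuclideanSpace ℝ (Fin d)) :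
    (secondMomentMatrix P m - secondMomentMatrix (densityMeasure f) m).PosSemidef := by
  have := hP.isProbabilityMeasure
  have := hf.1.isProbabilityMeasure
  have hf2 := hf.1.memLp_two
  refine Matrix.PosSemidef.of_dotProduct_mulVec_nonneg
    ((isHermitian_secondMomentMatrix m).sub (isHermitian_secondMomentMatrix m)) fun w => ?_
  rw [star_trivial, Matrix.sub_mulVec, dotProduct_sub, dotProduct_secondMomentMatrix_mulVec hP2,
    dotProduct_secondMomentMatrix_mulVec hf2, sub_nonneg,
    ← ENNReal.ofReal_le_ofReal_iff (integral_nonneg fun _ => sq_nonneg _),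
    ofReal_integral_eq_lintegral_ofReal (memLp_inner_sub hf2 _ m).integrable_sq
      (.of_forall fun _ => sq_nonneg _),
    ofReal_integral_eq_lintegral_ofReal (memLp_inner_sub hP2 _ m).integrable_sq
      (.of_forall fun _ => sq_nonneg _)]
  exact hf.lintegral_inner_sq_le hP _ m

end SecondMoments

end LogConcaveProjection

theorem mainTheorem3 {d : ℕ} (P : MeasureTheory.Measure (EuclideanSpace ℝ (Fin d)))
    (hP : LogConcaveProjection.MemPd P) :
    (∃ f, LogConcaveProjection.IsProjection P f) ∧
    ∀ f, LogConcaveProjection.IsProjection P f →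
      -- convex ordering; both extended integrals are well defined in `(-∞, ∞]`
      (∀ h : EuclideanSpace ℝ (Fin d) → EReal, LogConcaveProjection.IsExtConvex h →
        ∫⁻ x, (-h x).toENNReal ∂(LogConcaveProjection.densityMeasure f) < ∞ ∧
        ∫⁻ x, (-h x).toENNReal ∂P < ∞ ∧
        LogConcaveProjection.extIntegral (LogConcaveProjection.densityMeasure f) h ≤
          LogConcaveProjection.extIntegral P h) ∧
      -- the mean is preserved
      Integrable (fun x => x) (LogConcaveProjection.densityMeasure f) ∧
      Integrable (fun x => x) P ∧
      ∫ x, x ∂(LogConcaveProjection.densityMeasure f) = ∫ x, x ∂P ∧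
      -- the second moments about the mean shrink, in every direction
      MemLp (fun x => x) 2 (LogConcaveProjection.densityMeasure f) ∧
      (∀ v : EuclideanSpace ℝ (Fin d),
        ∫⁻ x, ENNReal.ofReal ((inner ℝ v (x - ∫ y, y ∂P)) ^ 2)
            ∂(LogConcaveProjection.densityMeasure f) ≤
          ∫⁻ x, ENNReal.ofReal ((inner ℝ v (x - ∫ y, y ∂P)) ^ 2) ∂P) ∧
      -- the covariance matrix shrinks, when `P` has one
      (MemLp (fun x => x) 2 P →
        (LogConcaveProjection.secondMomentMatrix P (∫ y, y ∂P) -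
          LogConcaveProjection.secondMomentMatrix (LogConcaveProjection.densityMeasure f)
            (∫ y, y ∂P)).PosSemidef) := by
  have := hP.isProbabilityMeasure
  refine ⟨hP.exists_isProjection, fun f hf => ?_⟩
  have := hf.1.isProbabilityMeasure
  exact ⟨fun h hh => ⟨hh.lintegral_neg_lt_top (hf.integrable_id hP),
      hh.lintegral_neg_lt_top hP.integrable_id, hf.extIntegral_le hP hh⟩,
    hf.integrable_id hP, hP.integrable_id, hf.integral_id_eq hP, hf.1.memLp_two,
    fun v => hf.lintegral_inner_sq_le hP v _, fun hP2 => hf.posSemidef_sub hP hP2 _⟩
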